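/- Let $n\ge 2$, let $m>1$ be real, and let $\Omega\subset\mathbb{C}^n$ be a bounded $m$-convex domain with Dini-smooth boundary. That is, $\Omega$ is a bounded convex domain; there is $c>0$ such that $\delta_\Omega(z;v)\le c\,\delta_\Omega(z)^{1/m}$ for all $z\in\Omega$ and $v\in\mathbb{C}^n\setminus\{0\}$, where $\delta_\Omega(z)=\inf\{|z-\xi|:\xi\in\partial\Omega\}$ and $\delta_\Omega(z;v)=\inf\{|z-\xi|:\xi\in\partial\Omega\cap(z+\mathbb{C}v)\}$; and every $p\in\partial\Omega$ has a neighbourhood $U$ in which $\partial\Omega$ is $C^1$ and such that the modulus of continuity $\omega(t)=\sup\{|\vec n(x)-\vec n(y)|: x,y\in\partial\Omega\cap U,\ |x-y|<t\}$ of the outer unit normal $\vec n$ satisfies $\int_0^1\frac{\omega(t)}{t}\,dt<\infty$. Let $d_K$ be the Kobayashi distance of $\Omega$, that is, the infimum of $\int_0^1K_\Omega(\gamma(t);\dot\gamma(t))\,dt$ over piecewise $C^1$ curves in $\Omega$ joining two given points, where $K_\Omega(x;v)=\inf\{|\xi|: f:\mathbb{D}\to\Omega \text{ holomorphic},\ f(0)=x,\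 df_0(\xi)=v\}$. Let $L$ denote Euclidean length of curves. 1. There is a constant $C>0$ such that for all $x,y\in\Omega$ and every Kobayashi geodesic $[x,y]$ from $x$ to $y$ (the image of an isometric embedding of $[0,d_K(x,y)]$ into $(\Omega,d_K)$ with endpoints $x$ and $y$), $$L([x,y])\le C\,|x-y|^{1/m}.$$ 2. Suppose in addition that $(\Omega,d_K)$ is Gromov hyperbolic, that is, there is $\delta\ge0$ with $(x|y)_w\ge\min\{(x|z)_w,(z|y)_w\}-\delta$ for all $x,y,z,w\in\Omega$, where $(x|y)_w=\frac12\big(d_K(x,w)+d_K(y,w)-d_K(x,y)\big)$. Then for every $\lambda\ge1$ there is a constant $C'>0$ such that for all $x,y\in\Omega$ and every Kobayashi $\lambda$-quasi-geodesic $\gamma$ from $x$ to $y$ (a map $\gamma:[a,b]\to\Omega$ with $\gamma(a)=x$, $\gamma(b)=y$ and $\lambda^{-1}|s-t|\le d_K(\gamma(s),\gamma(t))\le\lambda|s-t|$ for all $s,t\in[a,b]$), $$L(\gamma)\le C'\,|x-y|^{1/m}.$$ -/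

import Mathlib

open Set MeasureTheory
open scoped ENNReal

noncomputable section

namespace GehringHayman

/-- The boundary distance `δ_Ω(x) = inf {|x - ξ| : ξ ∈ ∂Ω}`. -/
def bdryDist {E : Type*} [NormedAddCommGroup E] (Ω : Set E) (x : E) : ℝ :=
  Metric.infDist x (frontier Ω)

/-- The boundary distance in the complex direction `v`,
`δ_Ω(x; v) = inf {|x - ξ| : ξ ∈ ∂Ω ∩ (x + ℂ v)}` (used for `v ≠ 0`). -/
def bdryDistDir {E : Type*} [NormedAddCommGroup E] [InnerProductSpace ℂ E]
    (Ω : Set E) (x v : E) : ℝ :=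
  Metric.infDist x (frontier Ω ∩ range fun c : ℂ => x + c • v)

/-- `Ω` is a bounded `m`-convex domain: a bounded convex domain such that, for some `C > 0`,
`δ_Ω(z; v) ≤ C δ_Ω(z)^{1/m}` for all `z ∈ Ω` and all directions `v`; here `m > 1` is real. -/
structure IsBoundedMConvex {E : Type*} [NormedAddCommGroup E] [InnerProductSpace ℂ E]
    (m : ℝ) (Ω : Set E) : Prop where
  one_lt : 1 < m
  isOpen : IsOpen Ω
  nonempty : Ω.Nonempty
  convex : Convex ℝ Ω
  bounded : Bornology.IsBounded Ω
  exists_bound : ∃ C : ℝ, 0 < C ∧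
    ∀ z ∈ Ω, ∀ v : E, v ≠ 0 → bdryDistDir Ω z v ≤ C * bdryDist Ω z ^ (1 / m)

/-- `r` is a local `C¹` defining function of `Ω` on the open set `U`. -/
structure IsLocalDefiningFunction {E : Type*} [NormedAddCommGroup E] [InnerProductSpace ℂ E]
    (Ω U : Set E) (r : E → ℝ) : Prop where
  contDiffOn : ContDiffOn ℝ 1 r U
  fderiv_ne_zero : ∀ x ∈ U, fderiv ℝ r x ≠ 0
  inter_eq : Ω ∩ U = {x ∈ U | r x < 0}

/-- `ν` is the outer unit normal vector field of `∂Ω` on `∂Ω ∩ U`, where `r` is a local defining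
function of `Ω` on `U`: `|ν x| = 1`, and `ν x` is the positive multiple of the real gradient of `r`,
i.e. `dr_x(v) = |dr_x| Re ⟨ν x, v⟩` for all `v`. -/
def IsOuterUnitNormal {E : Type*} [NormedAddCommGroup E] [InnerProductSpace ℂ E]
    (Ω U : Set E) (r : E → ℝ) (ν : E → E) : Prop :=
  ∀ x ∈ frontier Ω ∩ U, ‖ν x‖ = 1 ∧ ∀ v : E, fderiv ℝ r x v = ‖fderiv ℝ r x‖ * (inner ℂ (ν x) v).re

/-- The modulus of continuity `ω(ν, S, t) = sup {|ν x - ν y| : |x - y| < t, x, y ∈ S}`. -/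
def modulusOfContinuity {E : Type*} [NormedAddCommGroup E] (ν : E → E) (S : Set E) (t : ℝ) : ℝ :=
  sSup {s : ℝ | ∃ x ∈ S, ∃ y ∈ S, ‖x - y‖ < t ∧ s = ‖ν x - ν y‖}

/-- `p ∈ ∂Ω` is a Dini-smooth boundary point: `∂Ω` is `C¹` near `p`, and on some neighbourhood
`U` of `p` the modulus of continuity `ω` of the outer unit normal on `∂Ω ∩ U` satisfies
`∫₀¹ ω(t) / t dt < ∞`. -/
def IsDiniSmoothAt {E : Type*} [NormedAddCommGroup E] [InnerProductSpace ℂ E]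
    (Ω : Set E) (p : E) : Prop :=
  ∃ (U : Set E) (r : E → ℝ) (ν : E → E), IsOpen U ∧ p ∈ U ∧
    IsLocalDefiningFunction Ω U r ∧ IsOuterUnitNormal Ω U r ν ∧
    IntegrableOn (fun t : ℝ => modulusOfContinuity ν (frontier Ω ∩ U) t / t) (Ioc 0 1)

/-- Every boundary point of `Ω` is a Dini-smooth boundary point. -/
def HasDiniSmoothBoundary {E : Type*} [NormedAddCommGroup E] [InnerProductSpace ℂ E]
    (Ω : Set E) : Prop :=
  ∀ p ∈ frontier Ω, IsDiniSmoothAt Ω p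

/-- The infinitesimal Kobayashi metric
`K_Ω(x; v) = inf {|ξ| : f : 𝔻 → Ω holomorphic, f(0) = x, df₀(ξ) = v}`. -/
def kobayashiMetric {E : Type*} [NormedAddCommGroup E] [InnerProductSpace ℂ E]
    (Ω : Set E) (x v : E) : ℝ :=
  sInf {s : ℝ | ∃ (ξ : ℂ) (f : ℂ → E), DifferentiableOn ℂ f (Metric.ball 0 1) ∧
    MapsTo f (Metric.ball 0 1) Ω ∧ f 0 = x ∧ ξ • deriv f 0 = v ∧ s = ‖ξ‖}

/-- `γ` restricts to a piecewise `C¹` curve `[0,1] → Ω` from `x` to `y`: it is continuous, and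
`C¹` on each of the closed intervals of some partition `0 = t₀ ≤ t₁ ≤ … ≤ t_N = 1`. -/
structure IsPiecewiseC1Curve {E : Type*} [NormedAddCommGroup E] [InnerProductSpace ℂ E]
    (Ω : Set E) (x y : E) (γ : ℝ → E) : Prop where
  continuousOn : ContinuousOn γ (Icc 0 1)
  piecewise : ∃ (N : ℕ) (t : ℕ → ℝ), Monotone t ∧ t 0 = 0 ∧ t N = 1 ∧
    ∀ i < N, ContDiffOn ℝ 1 γ (Icc (t i) (t (i + 1)))
  mapsTo : MapsTo γ (Icc 0 1) Ω
  source : γ 0 = x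
  target : γ 1 = y

/-- The Kobayashi length `∫₀¹ K_Ω(γ(t); γ'(t)) dt`, with values in `[0, ∞]`. -/
def kobayashiLength {E : Type*} [NormedAddCommGroup E] [InnerProductSpace ℂ E]
    (Ω : Set E) (γ : ℝ → E) : ℝ≥0∞ :=
  ∫⁻ t in Icc (0 : ℝ) 1, ENNReal.ofReal (kobayashiMetric Ω (γ t) (deriv γ t))

/-- The Kobayashi distance `d_K`: the infimum of the Kobayashi lengths of the piecewise `C¹`
curves in `Ω` from `x` to `y`. (This infimum is finite for `x, y` in a domain `Ω`.) -/
def kobayashiDist {E : Type*} [NormedAddCommGroup E] [InnerProductSpace ℂ E]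
    (Ω : Set E) (x y : E) : ℝ :=
  (⨅ (γ : ℝ → E) (_ : IsPiecewiseC1Curve Ω x y γ), kobayashiLength Ω γ).toReal

/-- `γ` restricted to `[0, d_K(x,y)]` is a Kobayashi geodesic of `Ω` from `x` to `y`, i.e. an
isometric embedding of `[0, d_K(x,y)]` in `(Ω, d_K)` with these endpoints. -/
structure IsKobayashiGeodesic {E : Type*} [NormedAddCommGroup E] [InnerProductSpace ℂ E]
    (Ω : Set E) (x y : E) (γ : ℝ → E) : Prop where
  mapsTo : MapsTo γ (Icc 0 (kobayashiDist Ω x y)) Ω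
  source : γ 0 = x
  target : γ (kobayashiDist Ω x y) = y
  isometry : ∀ s ∈ Icc 0 (kobayashiDist Ω x y), ∀ t ∈ Icc 0 (kobayashiDist Ω x y),
    kobayashiDist Ω (γ s) (γ t) = |s - t|

/-- `γ` restricted to `[a, b]` is a Kobayashi `lam`-quasi-geodesic of `Ω` from `x` to `y`, i.e.
`lam⁻¹ |s - t| ≤ d_K(γ s, γ t) ≤ lam |s - t|` on `[a, b]`. -/
structure IsKobayashiQuasiGeodesic {E : Type*} [NormedAddCommGroup E] [InnerProductSpace ℂ E]
    (Ω : Set E) (lam : ℝ) (x y : E) (a b : ℝ) (γ : ℝ → E) : Prop where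
  le : a ≤ b
  mapsTo : MapsTo γ (Icc a b) Ω
  source : γ a = x
  target : γ b = y
  lower : ∀ s ∈ Icc a b, ∀ t ∈ Icc a b, lam⁻¹ * |s - t| ≤ kobayashiDist Ω (γ s) (γ t)
  upper : ∀ s ∈ Icc a b, ∀ t ∈ Icc a b, kobayashiDist Ω (γ s) (γ t) ≤ lam * |s - t|

/-- The Gromov product `(x|y)_w` with respect to the Kobayashi distance of `Ω`. -/
def gromovProduct {E : Type*} [NormedAddCommGroup E] [InnerProductSpace ℂ E]
    (Ω : Set E) (w x y : E) : ℝ :=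
  (kobayashiDist Ω x w + kobayashiDist Ω y w - kobayashiDist Ω x y) / 2

/-- `(Ω, d_K)` is Gromov hyperbolic: for some `δ ≥ 0`,
`(x|y)_w ≥ min {(x|z)_w, (z|y)_w} - δ` for all `x, y, z, w ∈ Ω`. -/
def IsKobayashiGromovHyperbolic {E : Type*} [NormedAddCommGroup E] [InnerProductSpace ℂ E]
    (Ω : Set E) : Prop :=
  ∃ δ : ℝ, 0 ≤ δ ∧ ∀ x ∈ Ω, ∀ y ∈ Ω, ∀ z ∈ Ω, ∀ w ∈ Ω,
    min (gromovProduct Ω w x z) (gromovProduct Ω w z y) - δ ≤ gromovProduct Ω w x y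

/-- The Euclidean length (in `[0, ∞]`) of the curve `γ` restricted to `[a, b]`. -/
def euclideanLength {E : Type*} [NormedAddCommGroup E] (γ : ℝ → E) (a b : ℝ) : ℝ≥0∞ :=
  eVariationOn γ (Icc a b)

end GehringHayman

end

/-!
Proof idea. Dini-smoothness makes the Kobayashi distance along an inward normal at most
`½ log (s' / s)`, up to a bounded error, between heights `s ≤ s'`. Pushing two points inwards by
their Euclidean distance therefore gives
`d_K(x, y) ≤ ½ log (1 + |x - y| / δ(x)) + ½ log (1 + |x - y| / δ(y)) + C`.
On the other hand, `δ` varies by a factor of at most `exp (2 d_K)`, by convexity. So if a curve from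
`x` to `y` is almost length-minimising (a geodesic, or, by stability, a quasi-geodesic of a
hyperbolic domain), the two estimates force `δ` to decay exponentially from the value `|x - y|` on
both sides of one parameter. By `m`-convexity, a piece of the curve of `d_K`-length at most one has
Euclidean length at most a multiple of `δ ^ (1 / m)`, and summing the geometric series bounds the
total length by a multiple of `|x - y| ^ (1 / m)`.
-/

namespace GehringHayman

variable {E : Type*} [NormedAddCommGroup E] [InnerProductSpace ℂ E] {Ω : Set E}

section DiskAutomorphism

theorem norm_add_lt_norm_one_add_conj_mul {z u : ℂ} (hz : ‖z‖ < 1) (hu : ‖u‖ < 1) :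
    ‖z + u‖ < ‖1 + starRingEnd ℂ u * z‖ := by
  have hz2 : 0 < 1 - ‖z‖ ^ 2 := by nlinarith [norm_nonneg z]
  have hu2 : 0 < 1 - ‖u‖ ^ 2 := by nlinarith [norm_nonneg u]
  have hsq : ‖1 + starRingEnd ℂ u * z‖ ^ 2 - ‖z + u‖ ^ 2 = (1 - ‖z‖ ^ 2) * (1 - ‖u‖ ^ 2) := by
    simp only [Complex.sq_norm, Complex.normSq_apply, Complex.add_re, Complex.add_im,
      Complex.mul_re, Complex.mul_im, Complex.conj_re, Complex.conj_im, Complex.one_re,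
      Complex.one_im]
    ring
  exact lt_of_pow_lt_pow_left₀ 2 (norm_nonneg _) (by linarith [mul_pos hz2 hu2])

/-- The automorphism `z ↦ (z + u) / (1 + ū z)` of the unit disc, which moves `0` to `u`. -/
noncomputable def diskAut (u z : ℂ) : ℂ := (z + u) / (1 + starRingEnd ℂ u * z)

theorem one_add_conj_mul_ne_zero {z u : ℂ} (hz : ‖z‖ < 1) (hu : ‖u‖ < 1) :
    1 + starRingEnd ℂ u * z ≠ 0 :=
  norm_pos_iff.1 ((norm_nonneg _).trans_lt (norm_add_lt_norm_one_add_conj_mul hz hu))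

theorem norm_diskAut_lt_one {z u : ℂ} (hz : ‖z‖ < 1) (hu : ‖u‖ < 1) : ‖diskAut u z‖ < 1 := by
  have h := norm_add_lt_norm_one_add_conj_mul hz hu
  rw [diskAut, norm_div]
  exact (div_lt_one ((norm_nonneg _).trans_lt h)).2 h

theorem hasDerivAt_diskAut {z u : ℂ} (hz : ‖z‖ < 1) (hu : ‖u‖ < 1) :
    HasDerivAt (diskAut u) ((1 - ‖u‖ ^ 2) / (1 + starRingEnd ℂ u * z) ^ 2) z := by
  have hnum : HasDerivAt (fun z : ℂ => z + u) 1 z := (hasDerivAt_id z).add_const _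
  have hden : HasDerivAt (fun z : ℂ => 1 + starRingEnd ℂ u * z) (starRingEnd ℂ u * 1) z :=
    ((hasDerivAt_id z).const_mul _).const_add 1
  refine (hnum.div hden (one_add_conj_mul_ne_zero hz hu)).congr_deriv ?_
  rw [← Complex.conj_mul']
  ring

end DiskAutomorphism

section KobayashiMetric

/-- The set of all `|ξ|` where `f : 𝔻 → Ω` is holomorphic with `f(0) = x` and `df₀(ξ) = v`; its
infimum is the Kobayashi metric `K_Ω(x; v)`. -/
def discNorms (Ω : Set E) (x v : E) : Set ℝ :=
  {s : ℝ | ∃ (ξ : ℂ) (f : ℂ → E), DifferentiableOn ℂ f (Metric.ball 0 1) ∧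
    MapsTo f (Metric.ball 0 1) Ω ∧ f 0 = x ∧ ξ • deriv f 0 = v ∧ s = ‖ξ‖}

theorem nonneg_of_mem_discNorms {x v : E} {s : ℝ} (hs : s ∈ discNorms Ω x v) : 0 ≤ s := by
  obtain ⟨ξ, -, -, -, -, -, rfl⟩ := hs
  exact norm_nonneg ξ

theorem kobayashiMetric_nonneg (Ω : Set E) (x v : E) : 0 ≤ kobayashiMetric Ω x v :=
  Real.sInf_nonneg fun _ => nonneg_of_mem_discNorms

theorem kobayashiMetric_le_of_mem_discNorms {x v : E} {s : ℝ} (hs : s ∈ discNorms Ω x v) :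
    kobayashiMetric Ω x v ≤ s :=
  csInf_le ⟨0, fun _ => nonneg_of_mem_discNorms⟩ hs

theorem norm_div_mem_discNorms {x v : E} {ρ : ℝ} (hρ : 0 < ρ) (hsub : Metric.ball x ρ ⊆ Ω) :
    ‖v‖ / ρ ∈ discNorms Ω x v := by
  set u : E := NormedSpace.normalize v
  have hu : ‖u‖ ≤ 1 := by
    rcases eq_or_ne v 0 with h0 | h0
    · simp [u, h0]
    · exact (NormedSpace.norm_normalize h0).le
  refine ⟨((‖v‖ / ρ : ℝ) : ℂ), fun z => x + z • ρ • u, by fun_prop, fun z hz => hsub ?_, by simp,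
    ?_, (Complex.norm_of_nonneg (by positivity)).symm⟩
  · rw [mem_ball_zero_iff] at hz
    rw [mem_ball_iff_norm, add_sub_cancel_left, norm_smul, norm_smul, Real.norm_of_nonneg hρ.le]
    calc ‖z‖ * (ρ * ‖u‖) ≤ ‖z‖ * (ρ * 1) := by gcongr
      _ < ρ := by nlinarith
  · have hd : HasDerivAt (fun z : ℂ => x + z • ρ • u) (ρ • u) 0 := by
      simpa using ((hasDerivAt_id (0 : ℂ)).smul_const (ρ • u)).const_add x
    rw [hd.deriv, Complex.coe_smul, smul_smul, div_mul_cancel₀ _ hρ.ne',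
      NormedSpace.norm_smul_normalize]

theorem kobayashiMetric_le_norm_div {x v : E} {ρ : ℝ} (hρ : 0 < ρ)
    (hsub : Metric.ball x ρ ⊆ Ω) : kobayashiMetric Ω x v ≤ ‖v‖ / ρ :=
  kobayashiMetric_le_of_mem_discNorms (norm_div_mem_discNorms hρ hsub)

theorem kobayashiMetric_le_of_ball_subset {c e : E} {ρ : ℝ} {u : ℂ} (a : ℂ) (hρ : 0 < ρ)
    (hu : ‖u‖ < 1) (he : ‖e‖ = 1) (hsub : Metric.ball c ρ ⊆ Ω) :
    kobayashiMetric Ω (c + (ρ * u) • e) (a • e) ≤ ‖a‖ / (ρ * (1 - ‖u‖ ^ 2)) := by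
  have hu2 : 0 < 1 - ‖u‖ ^ 2 := by nlinarith [norm_nonneg u]
  have hd : ∀ z : ℂ, ‖z‖ < 1 → HasDerivAt (fun z => c + (ρ * diskAut u z) • e)
      ((ρ * ((1 - ‖u‖ ^ 2) / (1 + starRingEnd ℂ u * z) ^ 2) : ℂ) • e) z := fun z hz =>
    (((hasDerivAt_diskAut hz hu).const_mul _).smul_const e).const_add c
  refine kobayashiMetric_le_of_mem_discNorms ⟨a / (ρ * (1 - ‖u‖ ^ 2)), _,
    fun z hz => (hd z (mem_ball_zero_iff.1 hz)).differentiableAt.differentiableWithinAt,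
    fun z hz => hsub ?_, ?_, ?_, ?_⟩
  · rw [mem_ball_iff_norm, add_sub_cancel_left, norm_smul, he, mul_one, norm_mul,
      Complex.norm_of_nonneg hρ.le]
    exact mul_lt_of_lt_one_right hρ (norm_diskAut_lt_one (mem_ball_zero_iff.1 hz) hu)
  · simp [diskAut]
  · have hden : (ρ * (1 - ‖u‖ ^ 2) : ℂ) ≠ 0 := by exact_mod_cast (mul_pos hρ hu2).ne'
    rw [(hd 0 (by simp)).deriv, smul_smul]
    simp [hden]
  · rw [norm_div]
    congr 1
    exact_mod_cast (Complex.norm_of_nonneg (mul_pos hρ hu2).le).symm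

theorem norm_mul_mem_discNorms_smul {x v : E} {s : ℝ} (a : ℂ) (hs : s ∈ discNorms Ω x v) :
    ‖a‖ * s ∈ discNorms Ω x (a • v) := by
  obtain ⟨ξ, f, hf, hmaps, h0, hv, rfl⟩ := hs
  exact ⟨a * ξ, f, hf, hmaps, h0, by rw [mul_smul, hv], (norm_mul a ξ).symm⟩

theorem kobayashiMetric_smul (Ω : Set E) (x v : E) {a : ℂ} (ha : a ≠ 0) :
    kobayashiMetric Ω x (a • v) = ‖a‖ * kobayashiMetric Ω x v := by
  change sInf (discNorms Ω x (a • v)) = ‖a‖ • sInf (discNorms Ω x v)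
  rw [← Real.sInf_smul_of_nonneg (norm_nonneg a)]
  congr 1
  ext s
  refine ⟨fun hs => ⟨‖a⁻¹‖ * s, ?_, ?_⟩, ?_⟩
  · simpa only [inv_smul_smul₀ ha] using norm_mul_mem_discNorms_smul a⁻¹ hs
  · simp [ha]
  · rintro ⟨s, hs, rfl⟩
    exact norm_mul_mem_discNorms_smul a hs

theorem norm_deriv_le_of_re_pos {h : ℂ → ℂ} (hd : DifferentiableOn ℂ h (Metric.ball 0 1))
    (hpos : ∀ z ∈ Metric.ball (0 : ℂ) 1, 0 < (h z).re) : ‖deriv h 0‖ ≤ 2 * (h 0).re := by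
  have h0 : 0 < (h 0).re := hpos 0 (by simp)
  have hder : HasDerivAt h (deriv h 0) 0 :=
    (hd.differentiableAt (Metric.ball_mem_nhds _ one_pos)).hasDerivAt
  have hbound : ∀ z ∈ Metric.ball (0 : ℂ) 1,
      ‖h z - h 0‖ ≤ 2 * (h 0).re * ‖z‖ / (1 - ‖z‖) := fun z hz => by
    rw [norm_sub_rev]
    refine Complex.borelCaratheodory_zero (f := fun z => h 0 - h z) h0 (hd.const_sub _) ?_ one_pos
      hz (sub_self _)
    exact fun w hw => by simpa using (hpos w hw).le
  refine le_of_forall_gt_imp_ge_of_dense fun C hC => ?_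
  have hlim : ∀ᶠ z : ℂ in nhds 0, 2 * (h 0).re / (1 - ‖z‖) < C := by
    have hcont : ContinuousAt (fun z : ℂ => 2 * (h 0).re / (1 - ‖z‖)) 0 :=
      ContinuousAt.div (by fun_prop) (by fun_prop) (by simp)
    exact hcont.eventually_lt_const (by simpa using hC)
  refine hder.le_of_lip' (by linarith) ?_
  filter_upwards [hlim, Metric.ball_mem_nhds _ one_pos] with z hzC hz
  rw [sub_zero]
  calc ‖h z - h 0‖ ≤ 2 * (h 0).re / (1 - ‖z‖) * ‖z‖ := (hbound z hz).trans_eq (by ring)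
    _ ≤ C * ‖z‖ := by gcongr

theorem norm_le_mul_kobayashiMetric (hΩ : IsOpen Ω) {x v : E} (hx : x ∈ Ω) {f : E →L[ℂ] ℂ} {c : ℂ}
    (hf : ∀ z ∈ Ω, 0 < (c - f z).re) : ‖f v‖ ≤ 2 * (c - f x).re * kobayashiMetric Ω x v := by
  have hpos := hf x hx
  obtain ⟨ρ, hρ, hsub⟩ := Metric.isOpen_iff.1 hΩ x hx
  rw [← div_le_iff₀' (by positivity)]
  refine le_csInf ⟨_, norm_div_mem_discNorms hρ hsub⟩ ?_
  rintro _ ⟨ξ, g, hg, hmaps, rfl, rfl, rfl⟩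
  have hga : DifferentiableAt ℂ g 0 := hg.differentiableAt (Metric.ball_mem_nhds _ one_pos)
  have hder : HasDerivAt (fun z => c - f (g z)) (-(f (deriv g 0))) 0 :=
    (f.hasFDerivAt.comp_hasDerivAt (0 : ℂ) hga.hasDerivAt).const_sub c
  have hschwarz : ‖f (deriv g 0)‖ ≤ 2 * (c - f (g 0)).re := by
    simpa only [hder.deriv, norm_neg] using norm_deriv_le_of_re_pos (h := fun z => c - f (g z))
      ((f.differentiable.comp_differentiableOn hg).const_sub c) fun z hz => hf _ (hmaps hz)
  rw [div_le_iff₀ (by positivity), map_smul, norm_smul]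
  gcongr

end KobayashiMetric

/-- Concatenation of two curves parametrised by `[0, 1]`. -/
noncomputable def concatCurve {F : Type*} (γ₁ γ₂ : ℝ → F) (t : ℝ) : F :=
  if t ≤ 1 / 2 then γ₁ (2 * t) else γ₂ (2 * t - 1)

theorem concatCurve_eqOn_left {F : Type*} (γ₁ γ₂ : ℝ → F) :
    EqOn (concatCurve γ₁ γ₂) (fun t => γ₁ (2 * t)) (Iic (1 / 2)) := fun _ ht => if_pos ht

theorem concatCurve_eqOn_right {F : Type*} (γ₁ γ₂ : ℝ → F) :
    EqOn (concatCurve γ₁ γ₂) (fun t => γ₂ (2 * t - 1)) (Ioi (1 / 2)) :=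
  fun _ ht => if_neg (not_le.2 ht)

theorem concatCurve_eqOn_right_of_eq {F : Type*} {γ₁ γ₂ : ℝ → F} (h : γ₁ 1 = γ₂ 0) :
    EqOn (concatCurve γ₁ γ₂) (fun t => γ₂ (2 * t - 1)) (Ici (1 / 2)) := by
  intro t ht
  rcases (mem_Ici.1 ht).eq_or_lt with rfl | hlt
  · simp [concatCurve, h]
  · exact concatCurve_eqOn_right γ₁ γ₂ hlt

section PiecewiseC1

variable {F : Type*} [NormedAddCommGroup F] [NormedSpace ℝ F] {γ γ' : ℝ → F} {a b : ℝ}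

/-- `γ` is piecewise `C¹` on `[a, b]`: finitely many consecutive closed intervals on which `γ` is
`C¹` lead from `a` to `b`. The inductive form makes concatenation of curves immediate. -/
def IsPiecewiseC1On (γ : ℝ → F) (a b : ℝ) : Prop :=
  Relation.ReflTransGen (fun s t => s ≤ t ∧ ContDiffOn ℝ 1 γ (Icc s t)) a b

theorem IsPiecewiseC1On.of_contDiffOn (h : ContDiffOn ℝ 1 γ (Icc a b)) (hab : a ≤ b) :
    IsPiecewiseC1On γ a b :=
  .single ⟨hab, h⟩

theorem isPiecewiseC1On_iff : IsPiecewiseC1On γ a b ↔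
    ∃ (N : ℕ) (t : ℕ → ℝ), Monotone t ∧ t 0 = a ∧ t N = b ∧
      ∀ i < N, ContDiffOn ℝ 1 γ (Icc (t i) (t (i + 1))) := by
  constructor
  · intro h
    induction h with
    | refl => exact ⟨0, fun _ => a, monotone_const, rfl, rfl, by simp⟩
    | @tail c d _ hcd ih =>
      obtain ⟨N, t, hmono, h0, hN, hC⟩ := ih
      refine ⟨N + 1, fun i => if i ≤ N then t i else d, monotone_nat_of_le_succ fun i => ?_,
        by simpa using h0, by simp, fun i hi => ?_⟩
      · rcases lt_trichotomy i N with h | rfl | h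
        · simpa only [h.le, Nat.succ_le_of_lt h, if_true] using hmono i.le_succ
        · simpa [hN] using hcd.1
        · simp [h.not_ge, (h.trans i.lt_succ_self).not_ge]
      · rcases (Nat.lt_succ_iff.1 hi).lt_or_eq with h | rfl
        · simpa only [h.le, Nat.succ_le_of_lt h, if_true] using hC i h
        · simpa [hN] using hcd.2
  · rintro ⟨N, t, hmono, rfl, rfl, hC⟩
    have hchain : Relation.ReflTransGen
        (fun i j => t i ≤ t j ∧ ContDiffOn ℝ 1 γ (Icc (t i) (t j))) 0 N :=
      reflTransGen_of_succ_of_le _ (fun i hi => ⟨hmono i.le_succ, hC i hi.2⟩) N.zero_le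
    exact hchain.lift t fun _ _ h => h

theorem IsPiecewiseC1On.le (h : IsPiecewiseC1On γ a b) : a ≤ b := by
  induction h with
  | refl => exact le_rfl
  | tail _ hcd ih => exact ih.trans hcd.1

theorem IsPiecewiseC1On.continuousOn (h : IsPiecewiseC1On γ a b) : ContinuousOn γ (Icc a b) := by
  induction h with
  | refl => simp
  | tail hac hcd ih =>
    rw [← Icc_union_Icc_eq_Icc (IsPiecewiseC1On.le hac) hcd.1]
    exact ih.union_of_isClosed hcd.2.continuousOn isClosed_Icc isClosed_Icc

theorem IsPiecewiseC1On.congr (h : IsPiecewiseC1On γ a b) (heq : EqOn γ' γ (Icc a b)) :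
    IsPiecewiseC1On γ' a b := by
  induction h with
  | refl => exact .refl
  | tail hac hcd ih =>
    exact (ih (heq.mono (Icc_subset_Icc_right hcd.1))).tail
      ⟨hcd.1, hcd.2.congr (heq.mono (Icc_subset_Icc_left (IsPiecewiseC1On.le hac)))⟩

theorem IsPiecewiseC1On.comp_affine (h : IsPiecewiseC1On γ a b) {k : ℝ} (hk : 0 < k) (c : ℝ) :
    IsPiecewiseC1On (fun t => γ (k * t - c)) ((a + c) / k) ((b + c) / k) := by
  refine Relation.ReflTransGen.lift (fun t => (t + c) / k) (fun s t hst => ⟨?_, ?_⟩) _ _ h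
  · exact div_le_div_of_nonneg_right (by linarith [hst.1]) hk.le
  · refine hst.2.comp (by fun_prop) fun r hr => ?_
    rw [mem_Icc, div_le_iff₀' hk, le_div_iff₀' hk] at hr
    exact ⟨by linarith [hr.1], by linarith [hr.2]⟩

theorem IsPiecewiseC1On.comp_const_sub (h : IsPiecewiseC1On γ a b) (c : ℝ) :
    IsPiecewiseC1On (fun t => γ (c - t)) (c - b) (c - a) := by
  refine Relation.reflTransGen_swap.1 (Relation.ReflTransGen.lift (c - ·) (fun s t hst => ?_) _ _ h)
  refine ⟨sub_le_sub_left hst.1 c, hst.2.comp (by fun_prop) fun r hr => ?_⟩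
  exact ⟨by linarith [hr.2], by linarith [hr.1]⟩

theorem IsPiecewiseC1On.concat {γ₁ γ₂ : ℝ → F} (h₁ : IsPiecewiseC1On γ₁ 0 1)
    (h₂ : IsPiecewiseC1On γ₂ 0 1) (h : γ₁ 1 = γ₂ 0) :
    IsPiecewiseC1On (concatCurve γ₁ γ₂) 0 1 := by
  have hleft : IsPiecewiseC1On (fun t => γ₁ (2 * t)) 0 (1 / 2) := by
    simpa using h₁.comp_affine two_pos 0
  have hright : IsPiecewiseC1On (fun t => γ₂ (2 * t - 1)) (1 / 2) 1 := by
    simpa [one_add_one_eq_two] using h₂.comp_affine two_pos 1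
  exact (hleft.congr ((concatCurve_eqOn_left γ₁ γ₂).mono Icc_subset_Iic_self)).trans
    (hright.congr ((concatCurve_eqOn_right_of_eq h).mono Icc_subset_Ici_self))

variable {x y z : E} {γ : ℝ → E}

theorem IsPiecewiseC1Curve.isPiecewiseC1On (h : IsPiecewiseC1Curve Ω x y γ) :
    IsPiecewiseC1On γ 0 1 :=
  isPiecewiseC1On_iff.2 h.piecewise

theorem IsPiecewiseC1On.isPiecewiseC1Curve (h : IsPiecewiseC1On γ 0 1)
    (hmaps : MapsTo γ (Icc 0 1) Ω) : IsPiecewiseC1Curve Ω (γ 0) (γ 1) γ :=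
  ⟨h.continuousOn, isPiecewiseC1On_iff.1 h, hmaps, rfl, rfl⟩

theorem IsPiecewiseC1Curve.reverse (h : IsPiecewiseC1Curve Ω x y γ) :
    IsPiecewiseC1Curve Ω y x (fun t => γ (1 - t)) := by
  have hpiecewise : IsPiecewiseC1On (fun t => γ (1 - t)) 0 1 := by
    simpa using h.isPiecewiseC1On.comp_const_sub 1
  simpa [h.source, h.target] using hpiecewise.isPiecewiseC1Curve (Ω := Ω) fun t ht =>
    h.mapsTo ⟨sub_nonneg.2 ht.2, sub_le_self 1 ht.1⟩

theorem IsPiecewiseC1Curve.concat {γ₁ γ₂ : ℝ → E} (h₁ : IsPiecewiseC1Curve Ω x y γ₁)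
    (h₂ : IsPiecewiseC1Curve Ω y z γ₂) : IsPiecewiseC1Curve Ω x z (concatCurve γ₁ γ₂) := by
  have heq : γ₁ 1 = γ₂ 0 := h₁.target.trans h₂.source.symm
  have hmaps : MapsTo (concatCurve γ₁ γ₂) (Icc 0 1) Ω := fun t ht => by
    rcases le_or_gt t (1 / 2) with hle | hgt
    · rw [concatCurve_eqOn_left γ₁ γ₂ hle]
      exact h₁.mapsTo ⟨by linarith [ht.1], by linarith⟩
    · rw [concatCurve_eqOn_right γ₁ γ₂ hgt]
      exact h₂.mapsTo ⟨by linarith, by linarith [ht.2]⟩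
  have h := (h₁.isPiecewiseC1On.concat h₂.isPiecewiseC1On heq).isPiecewiseC1Curve hmaps
  rw [concatCurve_eqOn_left γ₁ γ₂ (mem_Iic.2 (by norm_num)),
    concatCurve_eqOn_right γ₁ γ₂ (mem_Ioi.2 (by norm_num))] at h
  norm_num [h₁.source, h₂.target] at h
  exact h

end PiecewiseC1

section KobayashiLength

/-- The Kobayashi length of the part of the curve `γ` that is parametrised by `s`. -/
noncomputable def kobayashiLengthOn (Ω : Set E) (γ : ℝ → E) (s : Set ℝ) : ℝ≥0∞ :=
  ∫⁻ t in s, ENNReal.ofReal (kobayashiMetric Ω (γ t) (deriv γ t))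

theorem kobayashiLengthOn_Icc_zero_one (Ω : Set E) (γ : ℝ → E) :
    kobayashiLengthOn Ω γ (Icc 0 1) = kobayashiLength Ω γ := rfl

theorem kobayashiLengthOn_comp_affine (Ω : Set E) (γ : ℝ → E) {k c : ℝ} (hk : k ≠ 0)
    {s : Set ℝ} (hs : MeasurableSet s) :
    kobayashiLengthOn Ω (fun t => γ (k * t + c)) s =
      kobayashiLengthOn Ω γ ((fun t => k * t + c) '' s) := by
  have hderiv : ∀ t ∈ s, HasDerivWithinAt (fun t => k * t + c) k s t := fun t _ => by
    simpa using (((hasDerivAt_id t).const_mul k).add_const c).hasDerivWithinAt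
  have hinj : InjOn (fun t => k * t + c) s := fun _ _ _ _ h =>
    mul_left_cancel₀ hk (add_right_cancel h)
  rw [kobayashiLengthOn, kobayashiLengthOn,
    lintegral_image_eq_lintegral_abs_deriv_mul hs hderiv hinj]
  refine lintegral_congr fun t => ?_
  have hchain : deriv (fun t => γ (k * t + c)) t = (k : ℂ) • deriv γ (k * t + c) := by
    rw [deriv_comp_mul_left k (fun t => γ (t + c)), deriv_comp_add_const, Complex.coe_smul]
  rw [hchain, kobayashiMetric_smul _ _ _ (by exact_mod_cast hk), Complex.norm_real,
    ENNReal.ofReal_mul (norm_nonneg _), Real.norm_eq_abs]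

theorem kobayashiLengthOn_congr {γ₁ γ₂ : ℝ → E} {a b : ℝ} (h : EqOn γ₁ γ₂ (Ioo a b)) :
    kobayashiLengthOn Ω γ₁ (Icc a b) = kobayashiLengthOn Ω γ₂ (Icc a b) := by
  rw [kobayashiLengthOn, kobayashiLengthOn, ← restrict_Ioo_eq_restrict_Icc]
  refine setLIntegral_congr_fun measurableSet_Ioo fun t ht => ?_
  have he : γ₁ =ᶠ[nhds t] γ₂ := h.eventuallyEq_of_mem (Ioo_mem_nhds ht.1 ht.2)
  simp only [he.deriv_eq, he.self_of_nhds]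

theorem kobayashiLength_reverse (Ω : Set E) (γ : ℝ → E) :
    kobayashiLength Ω (fun t => γ (1 - t)) = kobayashiLength Ω γ := by
  have haff : (fun t : ℝ => 1 - t) = fun t => -1 * t + 1 := by ext; ring
  have h := kobayashiLengthOn_comp_affine Ω γ (k := -1) (c := 1) (by norm_num)
    (measurableSet_Icc (a := 0) (b := 1))
  rw [← haff, image_const_sub_Icc, sub_self, sub_zero] at h
  simpa only [kobayashiLengthOn_Icc_zero_one, neg_one_mul, neg_add_eq_sub] using h

theorem kobayashiLength_concat_le (Ω : Set E) (γ₁ γ₂ : ℝ → E) :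
    kobayashiLength Ω (concatCurve γ₁ γ₂) ≤ kobayashiLength Ω γ₁ + kobayashiLength Ω γ₂ := by
  have hleft : kobayashiLengthOn Ω (concatCurve γ₁ γ₂) (Icc 0 (1 / 2)) = kobayashiLength Ω γ₁ := by
    rw [kobayashiLengthOn_congr ((concatCurve_eqOn_left γ₁ γ₂).mono fun t ht => ht.2.le)]
    have h := kobayashiLengthOn_comp_affine Ω γ₁ (c := 0) two_ne_zero
      (measurableSet_Icc (a := 0) (b := 1 / 2))
    rw [image_affine_Icc' two_pos] at h
    norm_num at h ⊢
    exact h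
  have hright : kobayashiLengthOn Ω (concatCurve γ₁ γ₂) (Icc (1 / 2) 1) = kobayashiLength Ω γ₂ := by
    rw [kobayashiLengthOn_congr ((concatCurve_eqOn_right γ₁ γ₂).mono Ioo_subset_Ioi_self)]
    have h := kobayashiLengthOn_comp_affine Ω γ₂ (c := -1) two_ne_zero
      (measurableSet_Icc (a := 1 / 2) (b := 1))
    rw [image_affine_Icc' two_pos] at h
    norm_num [← sub_eq_add_neg] at h ⊢
    exact h
  rw [← hleft, ← hright, ← kobayashiLengthOn_Icc_zero_one,
    ← Icc_union_Icc_eq_Icc (b := (1 / 2 : ℝ)) (by norm_num) (by norm_num)]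
  exact lintegral_union_le _ _ _

end KobayashiLength

section KobayashiEDist

/-- The Kobayashi distance with values in `[0, ∞]`. -/
noncomputable def kobayashiEDist (Ω : Set E) (x y : E) : ℝ≥0∞ :=
  ⨅ (γ : ℝ → E) (_ : IsPiecewiseC1Curve Ω x y γ), kobayashiLength Ω γ

theorem kobayashiDist_eq_toReal (Ω : Set E) (x y : E) :
    kobayashiDist Ω x y = (kobayashiEDist Ω x y).toReal := rfl

theorem kobayashiDist_nonneg (Ω : Set E) (x y : E) : 0 ≤ kobayashiDist Ω x y :=
  ENNReal.toReal_nonneg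

theorem kobayashiEDist_comm (Ω : Set E) (x y : E) :
    kobayashiEDist Ω x y = kobayashiEDist Ω y x := by
  have hle : ∀ x y, kobayashiEDist Ω x y ≤ kobayashiEDist Ω y x := fun x y =>
    le_iInf₂ fun γ hγ => (iInf₂_le _ hγ.reverse).trans_eq (kobayashiLength_reverse Ω γ)
  exact le_antisymm (hle x y) (hle y x)

theorem kobayashiDist_comm (Ω : Set E) (x y : E) : kobayashiDist Ω x y = kobayashiDist Ω y x := by
  rw [kobayashiDist_eq_toReal, kobayashiEDist_comm, kobayashiDist_eq_toReal]

theorem kobayashiEDist_triangle (Ω : Set E) (x y z : E) :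
    kobayashiEDist Ω x z ≤ kobayashiEDist Ω x y + kobayashiEDist Ω y z :=
  ENNReal.le_iInf₂_add_iInf₂ fun γ₁ h₁ γ₂ h₂ =>
    (iInf₂_le _ (h₁.concat h₂)).trans (kobayashiLength_concat_le Ω γ₁ γ₂)

theorem kobayashiEDist_add_le_of_hasDerivAt {z v : E} {g g' : ℝ → ℝ}
    (hseg : ∀ t ∈ Icc (0 : ℝ) 1, z + t • v ∈ Ω)
    (hg : ∀ t ∈ Icc (0 : ℝ) 1, HasDerivAt g (g' t) t) (hc : ContinuousOn g' (Icc 0 1))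
    (hK : ∀ t ∈ Icc (0 : ℝ) 1, kobayashiMetric Ω (z + t • v) v ≤ g' t) :
    kobayashiEDist Ω z (z + v) ≤ ENNReal.ofReal (g 1 - g 0) := by
  have hsmooth : ContDiff ℝ 1 fun t : ℝ => z + t • v := by fun_prop
  have hγ : IsPiecewiseC1Curve Ω z (z + v) fun t => z + t • v := by
    simpa using (IsPiecewiseC1On.of_contDiffOn hsmooth.contDiffOn zero_le_one).isPiecewiseC1Curve
      hseg
  have hderiv : ∀ t : ℝ, deriv (fun t : ℝ => z + t • v) t = v := fun t => by
    simpa using (((hasDerivAt_id t).smul_const v).const_add z).deriv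
  have hu : uIcc (0 : ℝ) 1 = Icc 0 1 := uIcc_of_le zero_le_one
  have hg'0 : 0 ≤ᵐ[volume.restrict (Icc 0 1)] g' :=
    (ae_restrict_iff' measurableSet_Icc).2 <| .of_forall fun t ht =>
      (kobayashiMetric_nonneg _ _ _).trans (hK t ht)
  calc kobayashiEDist Ω z (z + v)
      ≤ ∫⁻ t in Icc (0 : ℝ) 1, ENNReal.ofReal (kobayashiMetric Ω (z + t • v) v) := by
        refine (iInf₂_le _ hγ).trans_eq ?_
        simp only [kobayashiLength, hderiv]
    _ ≤ ∫⁻ t in Icc (0 : ℝ) 1, ENNReal.ofReal (g' t) :=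
        setLIntegral_mono' measurableSet_Icc fun t ht => ENNReal.ofReal_le_ofReal (hK t ht)
    _ = ENNReal.ofReal (g 1 - g 0) := by
        rw [← ofReal_integral_eq_lintegral_ofReal hc.integrableOn_Icc hg'0,
          ← restrict_Ioc_eq_restrict_Icc, ← intervalIntegral.integral_of_le zero_le_one,
          intervalIntegral.integral_eq_sub_of_hasDerivAt (hu ▸ hg) (hu ▸ hc).intervalIntegrable]

theorem enorm_log_sub_log_le_lintegral (hΩ : IsOpen Ω) {γ : ℝ → E} {a b : ℝ} {f : E →L[ℂ] ℂ}
    {c : ℂ} (hab : a ≤ b) (hγ : ContDiffOn ℝ 1 γ (Icc a b)) (hmaps : MapsTo γ (Icc a b) Ω)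
    (hf : ∀ z ∈ Ω, 0 < (c - f z).re) :
    ‖Complex.log (c - f (γ b)) - Complex.log (c - f (γ a))‖ₑ ≤
      2 * kobayashiLengthOn Ω γ (Icc a b) := by
  have hslit : ∀ s ∈ Icc a b, c - f (γ s) ∈ Complex.slitPlane := fun s hs =>
    Or.inl (hf _ (hmaps hs))
  have hlog : ContDiffOn ℝ 1 (fun s => Complex.log (c - f (γ s))) (Icc a b) := fun s hs => by
    have hsub : ContDiffWithinAt ℝ 1 (fun s => c - f (γ s)) (Icc a b) s :=
      contDiffWithinAt_const.sub
        ((f.restrictScalars ℝ).contDiff.contDiffAt.comp_contDiffWithinAt s (hγ s hs))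
    exact ((Complex.contDiffAt_log (hslit s hs)).restrict_scalars ℝ).comp_contDiffWithinAt s hsub
  have hspeed : ∀ s ∈ Ioo a b, ‖deriv (fun s => Complex.log (c - f (γ s))) s‖ ≤
      2 * kobayashiMetric Ω (γ s) (deriv γ s) := fun s hs => by
    have hs' := Ioo_subset_Icc_self hs
    have hpos := hf _ (hmaps hs')
    have hre : (c - f (γ s)).re ≤ ‖c - f (γ s)‖ := Complex.re_le_norm _
    have hγs : HasDerivAt γ (deriv γ s) s :=
      (((hγ s hs').contDiffAt (Icc_mem_nhds hs.1 hs.2)).differentiableAt one_ne_zero).hasDerivAt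
    have hderiv : HasDerivAt (fun s => Complex.log (c - f (γ s)))
        (-(f (deriv γ s)) / (c - f (γ s))) s :=
      (((f.restrictScalars ℝ).hasFDerivAt.comp_hasDerivAt s hγs).const_sub c).clog_real
        (hslit s hs')
    rw [hderiv.deriv, norm_div, norm_neg, div_le_iff₀ (hpos.trans_le hre)]
    calc ‖f (deriv γ s)‖ ≤ 2 * (c - f (γ s)).re * kobayashiMetric Ω (γ s) (deriv γ s) :=
          norm_le_mul_kobayashiMetric hΩ (hmaps hs') hf
      _ = 2 * kobayashiMetric Ω (γ s) (deriv γ s) * (c - f (γ s)).re := by ring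
      _ ≤ _ := mul_le_mul_of_nonneg_left hre (mul_nonneg zero_le_two (kobayashiMetric_nonneg _ _ _))
  refine (enorm_sub_le_lintegral_deriv_of_contDiffOn_Icc hlog hab).trans ?_
  rw [kobayashiLengthOn, ← lintegral_const_mul' _ _ ENNReal.ofNat_ne_top,
    ← restrict_Ioo_eq_restrict_Icc]
  refine setLIntegral_mono' measurableSet_Ioo fun s hs => ?_
  rw [← ofReal_norm, ← ENNReal.ofReal_ofNat, ← ENNReal.ofReal_mul zero_le_two]
  exact ENNReal.ofReal_le_ofReal (hspeed s hs)

theorem IsPiecewiseC1On.enorm_log_sub_log_le (hΩ : IsOpen Ω) {γ : ℝ → E} {a b : ℝ}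
    {f : E →L[ℂ] ℂ} {c : ℂ} (hγ : IsPiecewiseC1On γ a b) (hmaps : MapsTo γ (Icc a b) Ω)
    (hf : ∀ z ∈ Ω, 0 < (c - f z).re) :
    ‖Complex.log (c - f (γ b)) - Complex.log (c - f (γ a))‖ₑ ≤
      2 * kobayashiLengthOn Ω γ (Icc a b) := by
  induction hγ with
  | refl => simp
  | @tail s t has hst ih =>
    have has : a ≤ s := IsPiecewiseC1On.le has
    have hadd : kobayashiLengthOn Ω γ (Icc a t) =
        kobayashiLengthOn Ω γ (Icc a s) + kobayashiLengthOn Ω γ (Icc s t) := by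
      rw [← Icc_union_Ioc_eq_Icc has hst.1, kobayashiLengthOn,
        lintegral_union measurableSet_Ioc (Set.disjoint_left.2 fun r hr hr' => hr'.1.not_ge hr.2),
        restrict_Ioc_eq_restrict_Icc, kobayashiLengthOn, kobayashiLengthOn]
    rw [hadd, mul_add, add_comm, ← sub_add_sub_cancel _ (Complex.log (c - f (γ s)))]
    exact (enorm_add_le _ _).trans <| add_le_add
      (enorm_log_sub_log_le_lintegral hΩ hst.1 hst.2
        (hmaps.mono_left (Icc_subset_Icc_left has)) hf)
      (ih (hmaps.mono_left (Icc_subset_Icc_right hst.1)))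

theorem enorm_log_sub_log_le (hΩ : IsOpen Ω) (x y : E) {f : E →L[ℂ] ℂ} {c : ℂ}
    (hf : ∀ z ∈ Ω, 0 < (c - f z).re) :
    ‖Complex.log (c - f y) - Complex.log (c - f x)‖ₑ ≤ 2 * kobayashiEDist Ω x y := by
  simp only [kobayashiEDist, ENNReal.mul_iInf_of_ne two_ne_zero ENNReal.ofNat_ne_top]
  refine le_iInf₂ fun γ hγ => ?_
  simpa only [hγ.source, hγ.target, kobayashiLengthOn_Icc_zero_one] using
    hγ.isPiecewiseC1On.enorm_log_sub_log_le hΩ hγ.mapsTo hf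

end KobayashiEDist

theorem notMem_of_mem_frontier {X : Type*} [TopologicalSpace X] {U : Set X} (hU : IsOpen U) {x : X}
    (hx : x ∈ frontier U) : x ∉ U := by
  rw [hU.frontier_eq] at hx
  exact hx.2

theorem inter_frontier_nonempty_of_isPreconnected {X : Type*} [TopologicalSpace X] {s U : Set X}
    (hU : IsOpen U) (hs : IsPreconnected s) (hin : (s ∩ U).Nonempty) (hout : (s ∩ Uᶜ).Nonempty) :
    (s ∩ frontier U).Nonempty := by
  by_contra hempty
  have hcover : s ⊆ U ∪ (closure U)ᶜ := fun z hz =>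
    or_iff_not_imp_left.2 fun hzU hzcl => hempty ⟨z, hz, hU.frontier_eq ▸ ⟨hzcl, hzU⟩⟩
  have hdisj : Disjoint U (closure U)ᶜ := disjoint_compl_right.mono_left subset_closure
  obtain ⟨y, hy, hyU⟩ := hout
  exact hyU <|
    hs.subset_left_of_subset_union hU isClosed_closure.isOpen_compl hdisj hcover hin hy

section BoundaryDistance

variable {F : Type*} [NormedAddCommGroup F] {D : Set F} {x : F}

theorem le_bdryDist_of_ball_subset (hD : IsOpen D) (hne : (frontier D).Nonempty) {ρ : ℝ}
    (h : Metric.ball x ρ ⊆ D) : ρ ≤ bdryDist D x :=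
  (Metric.le_infDist hne).2 fun _ hy => not_lt.1 fun hlt =>
    notMem_of_mem_frontier hD hy (h (Metric.mem_ball'.2 hlt))

theorem bdryDist_pos (hD : IsOpen D) (hne : (frontier D).Nonempty) (hx : x ∈ D) :
    0 < bdryDist D x := by
  obtain ⟨ρ, hρ, hball⟩ := Metric.isOpen_iff.1 hD x hx
  exact hρ.trans_le (le_bdryDist_of_ball_subset hD hne hball)

theorem bdryDist_le_add (D : Set F) (x y : F) : bdryDist D x ≤ bdryDist D y + ‖x - y‖ := by
  rw [← dist_eq_norm]
  exact Metric.infDist_le_infDist_add_dist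

variable [NormedSpace ℝ F]

theorem ball_bdryDist_subset (hD : IsOpen D) (hx : x ∈ D) : Metric.ball x (bdryDist D x) ⊆ D := by
  intro y hy
  by_contra hyD
  obtain ⟨z, hz, hzD⟩ := inter_frontier_nonempty_of_isPreconnected hD
    (convex_ball x (bdryDist D x)).isPreconnected
    ⟨x, Metric.mem_ball_self (Metric.pos_of_mem_ball hy), hx⟩ ⟨y, hy, hyD⟩
  exact Set.disjoint_left.1 Metric.disjoint_ball_infDist hz hzD

theorem ball_segment_subset (hD : Convex ℝ D) {y : F} {ρ t : ℝ} (ht : t ∈ Icc (0 : ℝ) 1)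
    (hx : Metric.ball x ρ ⊆ D) (hy : Metric.ball y ρ ⊆ D) :
    Metric.ball (x + t • (y - x)) ρ ⊆ D := by
  intro w hw
  obtain ⟨u, rfl⟩ : ∃ u, w = x + t • (y - x) + u := ⟨_, (add_sub_cancel _ w).symm⟩
  rw [mem_ball_iff_norm, add_sub_cancel_left] at hw
  have hxu : x + u ∈ D := hx (by simpa [mem_ball_iff_norm] using hw)
  have hyu : y + u ∈ D := hy (by simpa [mem_ball_iff_norm] using hw)
  convert hD hxu hyu (sub_nonneg.2 ht.2) ht.1 (sub_add_cancel 1 t) using 1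
  module

end BoundaryDistance

section KobayashiDist

variable {x y z : E} {ρ : ℝ}

theorem kobayashiEDist_le_norm_div (hC : Convex ℝ Ω) (hρ : 0 < ρ) (hx : Metric.ball x ρ ⊆ Ω)
    (hy : Metric.ball y ρ ⊆ Ω) : kobayashiEDist Ω x y ≤ ENNReal.ofReal (‖y - x‖ / ρ) := by
  have hball : ∀ t ∈ Icc (0 : ℝ) 1, Metric.ball (x + t • (y - x)) ρ ⊆ Ω := fun t ht =>
    ball_segment_subset hC ht hx hy
  have hderiv : ∀ t ∈ Icc (0 : ℝ) 1,
      HasDerivAt (fun t => ‖y - x‖ / ρ * t) (‖y - x‖ / ρ) t := fun t _ => by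
    simpa using (hasDerivAt_id t).const_mul (‖y - x‖ / ρ)
  simpa using kobayashiEDist_add_le_of_hasDerivAt
    (fun t ht => hball t ht (Metric.mem_ball_self hρ)) hderiv continuousOn_const
    (fun t ht => kobayashiMetric_le_norm_div hρ (hball t ht))

theorem kobayashiEDist_self (hO : IsOpen Ω) (hC : Convex ℝ Ω) (hx : x ∈ Ω) :
    kobayashiEDist Ω x x = 0 := by
  obtain ⟨ρ, hρ, hball⟩ := Metric.isOpen_iff.1 hO x hx
  simpa using kobayashiEDist_le_norm_div hC hρ hball hball

theorem kobayashiEDist_ne_top (hO : IsOpen Ω) (hC : Convex ℝ Ω) (hx : x ∈ Ω) (hy : y ∈ Ω) :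
    kobayashiEDist Ω x y ≠ ⊤ := by
  obtain ⟨ρ₁, hρ₁, hball₁⟩ := Metric.isOpen_iff.1 hO x hx
  obtain ⟨ρ₂, hρ₂, hball₂⟩ := Metric.isOpen_iff.1 hO y hy
  exact ne_top_of_le_ne_top ENNReal.ofReal_ne_top <| kobayashiEDist_le_norm_div hC (lt_min hρ₁ hρ₂)
    ((Metric.ball_subset_ball (min_le_left _ _)).trans hball₁)
    ((Metric.ball_subset_ball (min_le_right _ _)).trans hball₂)

theorem kobayashiDist_le_norm_div (hC : Convex ℝ Ω) (hρ : 0 < ρ) (hx : Metric.ball x ρ ⊆ Ω)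
    (hy : Metric.ball y ρ ⊆ Ω) : kobayashiDist Ω x y ≤ ‖y - x‖ / ρ :=
  ENNReal.toReal_le_of_le_ofReal (by positivity) (kobayashiEDist_le_norm_div hC hρ hx hy)

theorem kobayashiDist_self (hO : IsOpen Ω) (hC : Convex ℝ Ω) (hx : x ∈ Ω) :
    kobayashiDist Ω x x = 0 := by
  rw [kobayashiDist_eq_toReal, kobayashiEDist_self hO hC hx, ENNReal.toReal_zero]

theorem kobayashiDist_triangle (hO : IsOpen Ω) (hC : Convex ℝ Ω) (hx : x ∈ Ω) (hy : y ∈ Ω)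
    (hz : z ∈ Ω) : kobayashiDist Ω x z ≤ kobayashiDist Ω x y + kobayashiDist Ω y z := by
  have hxy := kobayashiEDist_ne_top hO hC hx hy
  have hyz := kobayashiEDist_ne_top hO hC hy hz
  simp only [kobayashiDist_eq_toReal]
  rw [← ENNReal.toReal_add hxy hyz]
  exact ENNReal.toReal_mono (ENNReal.add_ne_top.2 ⟨hxy, hyz⟩) (kobayashiEDist_triangle Ω x y z)

end KobayashiDist

section SupportingFunctional

variable {x y : E} {f : E →L[ℂ] ℂ} {c : ℂ}

theorem exists_re_sub_pos_of_mem_frontier (hO : IsOpen Ω) (hC : Convex ℝ Ω) {ξ : E}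
    (hξ : ξ ∈ frontier Ω) : ∃ f : E →L[ℂ] ℂ, ∀ z ∈ Ω, 0 < (f ξ - f z).re := by
  obtain ⟨f, hf⟩ :=
    RCLike.geometric_hahn_banach_open_point (𝕜 := ℂ) hC hO (notMem_of_mem_frontier hO hξ)
  exact ⟨f, fun z hz => by simpa using hf z hz⟩

theorem norm_map_sub_le_mul_exp_kobayashiDist (hO : IsOpen Ω) (hC : Convex ℝ Ω) (hx : x ∈ Ω)
    (hy : y ∈ Ω) (hf : ∀ z ∈ Ω, 0 < (c - f z).re) :
    ‖f (y - x)‖ ≤ ‖c - f x‖ * (Real.exp (2 * kobayashiDist Ω x y) - 1) := by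
  have hne : ∀ z ∈ Ω, c - f z ≠ 0 := fun z hz h => by simpa [h] using hf z hz
  set w := Complex.log (c - f y) - Complex.log (c - f x) with hw
  have hlog : ‖w‖ ≤ 2 * kobayashiDist Ω x y := by
    have hfin := ENNReal.mul_ne_top (ENNReal.ofNat_ne_top (n := 2))
      (kobayashiEDist_ne_top hO hC hx hy)
    simpa [kobayashiDist_eq_toReal] using ENNReal.toReal_mono hfin (enorm_log_sub_log_le hO x y hf)
  have hmul : (c - f x) * Complex.exp w = c - f y := by
    rw [hw, Complex.exp_sub, Complex.exp_log (hne y hy), Complex.exp_log (hne x hx),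
      mul_div_cancel₀ _ (hne x hx)]
  have hexp : ‖Complex.exp w - 1‖ ≤ Real.exp ‖w‖ - 1 := by
    simpa using Complex.norm_exp_sub_sum_le_exp_norm_sub_sum w 1
  calc ‖f (y - x)‖ = ‖(c - f x) * (Complex.exp w - 1)‖ := by
        rw [mul_sub, hmul, map_sub, ← norm_neg]; congr 1; ring
    _ ≤ ‖c - f x‖ * (Real.exp (2 * kobayashiDist Ω x y) - 1) := by
        rw [norm_mul]; gcongr; exact hexp.trans (by gcongr)

theorem opNorm_mul_le_re_of_ball_subset {ρ : ℝ} (hρ : 0 < ρ) (hx : Metric.ball x ρ ⊆ Ω)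
    (hf : ∀ z ∈ Ω, 0 < (c - f z).re) : ‖f‖ * ρ ≤ (c - f x).re := by
  have hopen : ∀ v ∈ Metric.ball (0 : E) ρ, ‖f v‖ ≤ (c - f x).re := fun v hv => by
    obtain ⟨a, ha, hav⟩ := RCLike.exists_norm_eq_mul_self (f v)
    have hmem : x + a • v ∈ Ω := hx (by simpa [mem_ball_iff_norm, norm_smul, ha] using hv)
    have hre : (f (a • v)).re = ‖f v‖ := by rw [map_smul, smul_eq_mul, ← hav]; simp
    have := hf _ hmem
    rw [map_add, ← sub_sub, Complex.sub_re, hre] at this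
    linarith
  have hclosed : Metric.closedBall (0 : E) ρ ⊆ {v | ‖f v‖ ≤ (c - f x).re} := by
    rw [← closure_ball 0 hρ.ne']
    exact closure_minimal hopen (isClosed_le (by fun_prop) continuous_const)
  exact (le_div_iff₀ hρ).1 (f.opNorm_bound_of_ball_bound hρ _ hclosed)

theorem bdryDist_le_mul_exp [ProperSpace E] (hO : IsOpen Ω) (hC : Convex ℝ Ω)
    (hne : (frontier Ω).Nonempty) (hx : x ∈ Ω) (hy : y ∈ Ω) :
    bdryDist Ω x ≤ bdryDist Ω y * Real.exp (2 * kobayashiDist Ω x y) := by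
  obtain ⟨ξ, hξ, hdist⟩ := isClosed_frontier.exists_infDist_eq_dist hne y
  obtain ⟨f, hf⟩ := exists_re_sub_pos_of_mem_frontier hO hC hξ
  have hfpos : 0 < ‖f‖ := norm_pos_iff.2 fun h => by simpa [h] using hf x hx
  have hfy : ‖f ξ - f y‖ ≤ ‖f‖ * bdryDist Ω y := by
    rw [← map_sub, bdryDist, hdist, dist_comm, dist_eq_norm]
    exact f.le_opNorm _
  refine le_of_mul_le_mul_left ?_ hfpos
  calc ‖f‖ * bdryDist Ω x
      ≤ (f ξ - f x).re :=
        opNorm_mul_le_re_of_ball_subset (bdryDist_pos hO hne hx) (ball_bdryDist_subset hO hx) hf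
    _ ≤ ‖f ξ - f x‖ := Complex.re_le_norm _
    _ = ‖(f ξ - f y) - f (x - y)‖ := by rw [map_sub, sub_sub_sub_cancel_right]
    _ ≤ ‖f ξ - f y‖ + ‖f ξ - f y‖ * (Real.exp (2 * kobayashiDist Ω x y) - 1) := by
        refine (norm_sub_le _ _).trans (add_le_add_right ?_ _)
        rw [kobayashiDist_comm]
        exact norm_map_sub_le_mul_exp_kobayashiDist hO hC hy hx hf
    _ = ‖f ξ - f y‖ * Real.exp (2 * kobayashiDist Ω x y) := by ring
    _ ≤ ‖f‖ * (bdryDist Ω y * Real.exp (2 * kobayashiDist Ω x y)) := by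
        rw [← mul_assoc]; gcongr

end SupportingFunctional

section ComplexLine

variable {x v : E}

theorem frontier_inter_range_smul_nonempty (hO : IsOpen Ω) (hB : Bornology.IsBounded Ω)
    (hx : x ∈ Ω) (hv : v ≠ 0) : (frontier Ω ∩ range fun c : ℂ => x + c • v).Nonempty := by
  obtain ⟨R, hR⟩ := hB.subset_ball x
  rw [inter_comm]
  refine inter_frontier_nonempty_of_isPreconnected hO (isPreconnected_range (by fun_prop))
    ⟨x, ⟨0, by simp⟩, hx⟩ ⟨x + ((R / ‖v‖ : ℝ) : ℂ) • v, ⟨_, rfl⟩, fun h => ?_⟩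
  have hlt : ‖((R / ‖v‖ : ℝ) : ℂ) • v‖ < R := by simpa [mem_ball_iff_norm] using hR h
  rw [norm_smul, Complex.norm_real, norm_div, norm_norm,
    div_mul_cancel₀ _ (norm_ne_zero_iff.2 hv)] at hlt
  exact hlt.not_ge (Real.le_norm_self R)

theorem exists_frontier_bdryDistDir_eq [ProperSpace E] (hO : IsOpen Ω) (hB : Bornology.IsBounded Ω)
    (hx : x ∈ Ω) (hv : v ≠ 0) :
    ∃ a : ℂ, x + a • v ∈ frontier Ω ∧ bdryDistDir Ω x v = ‖a‖ * ‖v‖ := by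
  have hclosed : IsClosed (range fun c : ℂ => x + c • v) :=
    ((Homeomorph.addLeft x).isClosedEmbedding.comp (isClosedEmbedding_smul_left hv)).isClosed_range
  obtain ⟨_, ⟨hξ, a, rfl⟩, hdist⟩ := (isClosed_frontier.inter hclosed).exists_infDist_eq_dist
    (frontier_inter_range_smul_nonempty hO hB hx hv) x
  exact ⟨a, hξ, by rw [bdryDistDir, hdist, dist_self_add_right, norm_smul]⟩

theorem norm_sub_le_bdryDistDir_mul [ProperSpace E] (hO : IsOpen Ω) (hC : Convex ℝ Ω)
    (hB : Bornology.IsBounded Ω) {y : E} (hx : x ∈ Ω) (hy : y ∈ Ω) (hxy : y - x ≠ 0) :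
    ‖y - x‖ ≤ bdryDistDir Ω x (y - x) * (Real.exp (2 * kobayashiDist Ω x y) - 1) := by
  obtain ⟨a, ha, hdist⟩ := exists_frontier_bdryDistDir_eq hO hB hx hxy
  obtain ⟨f, hf⟩ := exists_re_sub_pos_of_mem_frontier hO hC ha
  have hfa : f (x + a • (y - x)) - f x = a * f (y - x) := by simp
  have hfpos : 0 < ‖f (y - x)‖ := norm_pos_iff.2 fun h => by simpa [hfa, h] using hf x hx
  have hbound := norm_map_sub_le_mul_exp_kobayashiDist hO hC hx hy hf
  rw [hfa, norm_mul] at hbound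
  have hone : 1 ≤ ‖a‖ * (Real.exp (2 * kobayashiDist Ω x y) - 1) :=
    le_of_mul_le_mul_right (by linarith) hfpos
  rw [hdist, mul_right_comm]
  exact le_mul_of_one_le_left (norm_nonneg _) hone

end ComplexLine

section DiniModulus

theorem summable_dyadic_of_integrableOn_div {f : ℝ → ℝ} (hnonneg : ∀ t, 0 ≤ f t)
    (hmono : MonotoneOn f (Ioi 0)) (hinteg : IntegrableOn (fun t => f t / t) (Ioc 0 1)) :
    Summable fun k : ℕ => f ((1 / 2) ^ k) := by
  rw [← summable_nat_add_iff 1]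
  set a : ℕ → ℝ := fun k => (1 / 2) ^ k with ha
  have hanti : Antitone a := pow_right_anti₀ (by norm_num) (by norm_num)
  have hpos : ∀ k, 0 < a k := fun k => by positivity
  have hsub : ∀ k, Ioc (a (k + 1)) (a k) ⊆ Ioc 0 1 := fun k =>
    Ioc_subset_Ioc (hpos _).le (pow_le_one₀ (by norm_num) (by norm_num))
  have hsum : Summable fun k => ∫ t in Ioc (a (k + 1)) (a k), f t / t :=
    (hasSum_integral_iUnion (fun _ => measurableSet_Ioc) hanti.pairwise_disjoint_on_Ioc_succ
      (hinteg.mono_set (iUnion_subset hsub))).summable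
  refine Summable.of_nonneg_of_le (fun k => hnonneg _) (fun k => ?_) (hsum.mul_left 2)
  have hconst : ∫ _ in Ioc (a (k + 1)) (a k), f (a (k + 1)) / a k = f (a (k + 1)) / 2 := by
    have hhalf : a k - a (k + 1) = a k / 2 := by simp only [ha, pow_succ]; ring
    rw [setIntegral_const, Real.volume_real_Ioc_of_le (hanti (Nat.le_succ k)), smul_eq_mul, hhalf]
    field_simp [(hpos k).ne']
  have hle : ∫ _ in Ioc (a (k + 1)) (a k), f (a (k + 1)) / a k ≤
      ∫ t in Ioc (a (k + 1)) (a k), f t / t := by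
    refine setIntegral_mono_on (integrableOn_const (by simp)) (hinteg.mono_set (hsub k))
      measurableSet_Ioc fun t ht => ?_
    have htpos : 0 < t := (hpos _).trans ht.1
    exact div_le_div₀ (hnonneg t) (hmono (hpos _) htpos ht.1.le) htpos ht.2
  linarith

theorem exists_summable_majorant_half_le {ω : ℕ → ℝ} (hpos : ∀ k, 0 ≤ ω k) (hsum : Summable ω) :
    ∃ w : ℕ → ℝ, (∀ k, ω k ≤ w k) ∧ Summable w ∧ ∀ k, w k / 2 ≤ w (k + 1) := by
  let w : ℕ → ℝ := fun k => Nat.rec (ω 0) (fun k wk => wk / 2 + ω (k + 1)) k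
  have hwpos : ∀ k, 0 ≤ w k := fun k => by
    induction k with
    | zero => exact hpos 0
    | succ k ih => exact add_nonneg (div_nonneg ih zero_le_two) (hpos _)
  refine ⟨w, fun k => ?_, ?_, fun k => le_add_of_nonneg_right (hpos _)⟩
  · cases k with
    | zero => exact le_rfl
    | succ k => exact le_add_of_nonneg_left (div_nonneg (hwpos k) zero_le_two)
  have hpart : ∀ n,
      ∑ k ∈ Finset.range n, w k + 2 * w n = 2 * ∑ k ∈ Finset.range (n + 1), ω k := by
    intro n
    induction n with
    | zero => simp [w]
    | succ n ih =>
      have hw : w (n + 1) = w n / 2 + ω (n + 1) := rfl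
      rw [Finset.sum_range_succ, Finset.sum_range_succ _ (n + 1), hw]
      linarith
  refine summable_of_sum_range_le (c := 2 * ∑' k, ω k) hwpos fun n => ?_
  have := hsum.sum_le_tsum (Finset.range (n + 1)) fun k _ => hpos k
  linarith [hpart n, hwpos n]

variable {F : Type*} [NormedAddCommGroup F] {ν : F → F} {S : Set F}

theorem norm_sub_le_modulusOfContinuity (hν : ∀ x ∈ S, ‖ν x‖ = 1) {x y : F} (hx : x ∈ S)
    (hy : y ∈ S) {t : ℝ} (hxy : ‖x - y‖ < t) : ‖ν x - ν y‖ ≤ modulusOfContinuity ν S t := by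
  refine le_csSup ⟨2, ?_⟩ ⟨x, hx, y, hy, hxy, rfl⟩
  rintro _ ⟨a, ha, b, hb, -, rfl⟩
  linarith [norm_sub_le (ν a) (ν b), hν a ha, hν b hb]

theorem modulusOfContinuity_nonneg (ν : F → F) (S : Set F) (t : ℝ) :
    0 ≤ modulusOfContinuity ν S t :=
  Real.sSup_nonneg (by rintro _ ⟨a, -, b, -, -, rfl⟩; positivity)

theorem modulusOfContinuity_monotoneOn (hν : ∀ x ∈ S, ‖ν x‖ = 1) :
    MonotoneOn (modulusOfContinuity ν S) (Ioi 0) := by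
  intro s _ t _ hst
  refine Real.sSup_le ?_ (modulusOfContinuity_nonneg _ _ _)
  rintro _ ⟨a, ha, b, hb, hab, rfl⟩
  exact norm_sub_le_modulusOfContinuity hν ha hb (hab.trans_le hst)

theorem exists_summable_majorant_modulusOfContinuity (hν : ∀ x ∈ S, ‖ν x‖ = 1)
    (hinteg : IntegrableOn (fun t : ℝ => modulusOfContinuity ν S t / t) (Ioc 0 1)) :
    ∃ w : ℕ → ℝ, (∀ k, 0 < w k) ∧ (∀ k, modulusOfContinuity ν S ((1 / 2) ^ k) ≤ w k) ∧
      Summable w ∧ ∀ k, w k / 2 ≤ w (k + 1) := by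
  have hnonneg := modulusOfContinuity_nonneg ν S
  have hgeom : ∀ k, (0 : ℝ) < (1 / 2) ^ k := fun k => by positivity
  obtain ⟨w, hle, hsum, hhalf⟩ := exists_summable_majorant_half_le
    (fun k => add_nonneg (hnonneg ((1 / 2) ^ k)) (hgeom k).le)
    ((summable_dyadic_of_integrableOn_div hnonneg (modulusOfContinuity_monotoneOn hν) hinteg).add
      summable_geometric_two)
  exact ⟨w, fun k => (add_pos_of_nonneg_of_pos (hnonneg _) (hgeom k)).trans_le (hle k),
    fun k => (le_add_of_nonneg_right (hgeom k).le).trans (hle k), hsum, hhalf⟩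

end DiniModulus

section InteriorCone

theorem re_inner_smul_right (x y : E) (t : ℝ) :
    (inner ℂ x (t • y)).re = t * (inner ℂ x y).re := by
  rw [← Complex.coe_smul, inner_smul_right, Complex.re_ofReal_mul]

theorem re_inner_outerUnitNormal_nonpos (hO : IsOpen Ω) (hC : Convex ℝ Ω) {U : Set E} {r : E → ℝ}
    {ν : E → E} (hU : IsOpen U) (hr : IsLocalDefiningFunction Ω U r)
    (hν : IsOuterUnitNormal Ω U r ν) {p x : E} (hp : p ∈ frontier Ω ∩ U) (hx : x ∈ Ω) :
    (inner ℂ (ν p) (x - p)).re ≤ 0 := by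
  have hnonneg : 0 ≤ r p := not_lt.1 fun hlt => notMem_of_mem_frontier hO hp.1
    (hr.inter_eq.symm.subset ⟨hp.2, hlt⟩ : p ∈ Ω ∩ U).1
  have hmax : IsLocalMaxOn r Ω p := by
    filter_upwards [self_mem_nhdsWithin, mem_nhdsWithin_of_mem_nhds (hU.mem_nhds hp.2)]
      with z hz hzU
    exact (hr.inter_eq.subset ⟨hz, hzU⟩).2.le.trans hnonneg
  have hdiff : DifferentiableAt ℝ r p :=
    ((hr.contDiffOn p hp.2).contDiffAt (hU.mem_nhds hp.2)).differentiableAt one_ne_zero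
  have hcone : x - p ∈ posTangentConeAt Ω p := by
    refine sub_mem_posTangentConeAt_of_openSegment_subset ?_
    simpa only [hO.interior_eq] using hC.openSegment_closure_interior_subset_interior
      (frontier_subset_closure hp.1) (hO.interior_eq.symm ▸ hx)
  have hfderiv : fderiv ℝ r p (x - p) ≤ 0 :=
    hmax.hasFDerivWithinAt_nonpos hdiff.hasFDerivAt.hasFDerivWithinAt hcone
  rw [(hν p hp).2] at hfderiv
  exact nonpos_of_mul_nonpos_right hfderiv (norm_pos_iff.2 (hr.fderiv_ne_zero p hp.2))

theorem exists_frontier_re_inner_nonneg (hO : IsOpen Ω) {x z : E} (hx : x ∈ Ω) (hz : z ∉ Ω) :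
    ∃ q ∈ frontier Ω ∩ segment ℝ x z, ∀ N : E, (∀ y ∈ Ω, (inner ℂ N (y - q)).re ≤ 0) →
      0 ≤ (inner ℂ N (z - x)).re := by
  obtain ⟨q, hq, hqΩ⟩ := inter_frontier_nonempty_of_isPreconnected hO
    (convex_segment x z).isPreconnected ⟨x, left_mem_segment ℝ _ _, hx⟩
    ⟨z, right_mem_segment ℝ _ _, hz⟩
  refine ⟨q, ⟨hqΩ, hq⟩, fun N hN => ?_⟩
  rw [segment_eq_image'] at hq
  obtain ⟨θ, hθ, rfl⟩ := hq
  have hθpos : 0 < θ := hθ.1.lt_of_ne fun h =>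
    notMem_of_mem_frontier hO hqΩ (by simpa [← h] using hx)
  have hsub : x - (x + θ • (z - x)) = (-θ) • (z - x) := by module
  have hneg := hN x hx
  rw [hsub, re_inner_smul_right] at hneg
  exact nonneg_of_mul_nonneg_right (by linarith : 0 ≤ θ * _) hθpos

theorem add_mem_of_re_inner_lt (hO : IsOpen Ω) {ν : E → E} {p w : E} {t ω : ℝ}
    (hp : p ∈ frontier Ω) (hunit : ∀ q ∈ frontier Ω ∩ Metric.ball p t, ‖ν q‖ = 1)
    (hsupp : ∀ q ∈ frontier Ω ∩ Metric.ball p t, ∀ x ∈ Ω, (inner ℂ (ν q) (x - q)).re ≤ 0)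
    (hω : ∀ q ∈ frontier Ω ∩ Metric.ball p t, ‖ν p - ν q‖ ≤ ω)
    (hwt : ‖w‖ < t) (hw : (inner ℂ (ν p) w).re < -(ω * ‖w‖)) : p + w ∈ Ω := by
  by_contra hz
  obtain ⟨x, hx, hdist⟩ := Metric.mem_closure_iff.1 (frontier_subset_closure hp)
    (min (-(ω * ‖w‖) - (inner ℂ (ν p) w).re) t)
    (lt_min (sub_pos.2 hw) ((norm_nonneg _).trans_lt hwt))
  obtain ⟨hxp, hxt⟩ := lt_min_iff.1 hdist
  rw [dist_eq_norm] at hxp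
  obtain ⟨q, ⟨hqΩ, hq⟩, hqN⟩ := exists_frontier_re_inner_nonneg hO hx hz
  have hqt : q ∈ frontier Ω ∩ Metric.ball p t := ⟨hqΩ, (convex_ball p t).segment_subset
    (Metric.mem_ball'.2 hxt) (by simpa [mem_ball_iff_norm] using hwt) hq⟩
  have hturn : (inner ℂ (ν q - ν p) w).re ≤ ω * ‖w‖ :=
    (re_inner_le_norm (𝕜 := ℂ) _ _).trans <| by
      rw [norm_sub_rev]; exact mul_le_mul_of_nonneg_right (hω q hqt) (norm_nonneg _)
  have hshift : (inner ℂ (ν q) (p - x)).re ≤ ‖p - x‖ := by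
    have hle : (inner ℂ (ν q) (p - x)).re ≤ _ := re_inner_le_norm (𝕜 := ℂ) _ _
    rwa [hunit q hqt, one_mul] at hle
  have hout := hqN _ (hsupp q hqt)
  rw [add_comm p, add_sub_assoc, inner_add_right, Complex.add_re] at hout
  rw [inner_sub_left, Complex.sub_re] at hturn
  linarith

theorem ball_subset_of_cone {p N : E} {t ω R : ℝ} (hN : ‖N‖ = 1) (hω : |ω| ≤ 1) (hR : 0 < R)
    (hRt : 2 * R ≤ t)
    (hcone : ∀ w : E, ‖w‖ < t → (inner ℂ N w).re < -(ω * ‖w‖) → p + w ∈ Ω) :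
    Metric.ball (p - R • N) (R * (1 - ω ^ 2)) ⊆ Ω := by
  intro z hz
  obtain ⟨w, rfl⟩ : ∃ w, z = p + w := ⟨_, (add_sub_cancel p z).symm⟩
  have hball : ‖w + R • N‖ < R * (1 - ω ^ 2) := by
    rwa [mem_ball_iff_norm, show p + w - (p - R • N) = w + R • N by abel] at hz
  have hRN : ‖R • N‖ = R := by rw [norm_smul, hN, Real.norm_of_nonneg hR.le, mul_one]
  have hω2 : ω ^ 2 ≤ 1 := (sq_le_one_iff_abs_le_one ω).2 hω
  refine hcone w ?_ (lt_of_mul_lt_mul_left ?_ hR.le)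
  · have hle : ‖w‖ ≤ ‖w + R • N‖ + ‖R • N‖ := by simpa using norm_sub_le (w + R • N) (R • N)
    nlinarith [mul_nonneg hR.le (sq_nonneg ω)]
  · have hexpand : ‖w + R • N‖ ^ 2 = ‖w‖ ^ 2 + 2 * (R * (inner ℂ N w).re) + R ^ 2 := by
      rw [norm_add_sq (𝕜 := ℂ), hRN, RCLike.re_eq_complex_re, re_inner_smul_right,
        ← inner_conj_symm, Complex.conj_re]
    have hsq : ‖w + R • N‖ ^ 2 < R ^ 2 * (1 - ω ^ 2) := by
      calc ‖w + R • N‖ ^ 2 < (R * (1 - ω ^ 2)) ^ 2 := by gcongr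
        _ = R ^ 2 * (1 - ω ^ 2) * (1 - ω ^ 2) := by ring
        _ ≤ R ^ 2 * (1 - ω ^ 2) := mul_le_of_le_one_right
            (mul_nonneg (sq_nonneg R) (sub_nonneg.2 hω2)) (by linarith [sq_nonneg ω])
    linarith [sq_nonneg (‖w‖ - R * ω)]

theorem ball_sub_smul_outerUnitNormal_subset (hO : IsOpen Ω) (hC : Convex ℝ Ω) {U : Set E}
    {r : E → ℝ} {ν : E → E} (hU : IsOpen U) (hr : IsLocalDefiningFunction Ω U r)
    (hν : IsOuterUnitNormal Ω U r ν) {p : E} (hp : p ∈ frontier Ω) {t R ω : ℝ}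
    (hpU : Metric.ball p t ⊆ U) (hω : modulusOfContinuity ν (frontier Ω ∩ U) t ≤ ω) (hω1 : ω ≤ 1)
    (hR : 0 < R) (hRt : 2 * R ≤ t) :
    Metric.ball (p - R • ν p) (R * (1 - ω ^ 2)) ⊆ Ω := by
  have hunit : ∀ q ∈ frontier Ω ∩ U, ‖ν q‖ = 1 := fun q hq => (hν q hq).1
  have hmem : ∀ q ∈ frontier Ω ∩ Metric.ball p t, q ∈ frontier Ω ∩ U := fun q hq =>
    ⟨hq.1, hpU hq.2⟩
  have hp' : p ∈ frontier Ω ∩ U := hmem p ⟨hp, Metric.mem_ball_self (by linarith)⟩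
  have hω0 : 0 ≤ ω := (modulusOfContinuity_nonneg _ _ _).trans hω
  refine ball_subset_of_cone (hunit p hp') (abs_le.2 ⟨by linarith, hω1⟩) hR hRt fun w hw hcone =>
    add_mem_of_re_inner_lt hO hp (fun q hq => hunit q (hmem q hq))
      (fun q hq x hx => re_inner_outerUnitNormal_nonpos hO hC hU hr hν (hmem q hq) hx)
      (fun q hq => ?_) hw hcone
  refine (norm_sub_le_modulusOfContinuity hunit hp' (hmem q hq) ?_).trans hω
  rw [← dist_eq_norm, dist_comm]
  exact hq.2

end InteriorCone

section NormalEstimate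

open Filter Topology

theorem neg_two_mul_le_log_one_sub {x : ℝ} (h0 : 0 ≤ x) (h1 : x ≤ 1 / 2) :
    -(2 * x) ≤ Real.log (1 - x) := by
  have hinv : (1 - x)⁻¹ ≤ 1 + 2 * x := by
    rw [inv_le_iff_one_le_mul₀ (by linarith)]
    nlinarith
  linarith [Real.one_sub_inv_le_log_of_pos (x := 1 - x) (by linarith)]

theorem kobayashiMetric_diameter_le {c e : E} {ρ t : ℝ} (a : ℝ) (he : ‖e‖ = 1)
    (hsub : Metric.ball c ρ ⊆ Ω) (ht : |t| < ρ) :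
    kobayashiMetric Ω (c + t • e) (a • e) ≤ |a| * ρ / ((ρ + t) * (ρ - t)) := by
  have hρ : 0 < ρ := (abs_nonneg t).trans_lt ht
  have hu : ‖((t / ρ : ℝ) : ℂ)‖ < 1 := by
    rwa [Complex.norm_real, Real.norm_eq_abs, abs_div, abs_of_pos hρ, div_lt_one hρ]
  have hle := kobayashiMetric_le_of_ball_subset (a : ℂ) hρ hu he hsub
  rw [← Complex.ofReal_mul, mul_div_cancel₀ _ hρ.ne', Complex.coe_smul, Complex.coe_smul,
    Complex.norm_real, Complex.norm_real, Real.norm_eq_abs, Real.norm_eq_abs, sq_abs] at hle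
  refine hle.trans_eq ?_
  rw [show ρ * (1 - (t / ρ) ^ 2) = (ρ + t) * (ρ - t) / ρ by field_simp; ring, div_div_eq_mul_div]

theorem kobayashiEDist_diameter_le {c e : E} {ρ a b : ℝ} (he : ‖e‖ = 1)
    (hsub : Metric.ball c ρ ⊆ Ω) (ha : -ρ < a) (hab : a ≤ b) (hb : b < ρ) :
    kobayashiEDist Ω (c + a • e) (c + b • e) ≤
      ENNReal.ofReal (1 / 2 * (Real.log (ρ + b) - Real.log (ρ - b)) -
        1 / 2 * (Real.log (ρ + a) - Real.log (ρ - a))) := by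
  set σ : ℝ → ℝ := fun t => a + (b - a) * t with hσ
  have hmem : ∀ t ∈ Icc (0 : ℝ) 1, 0 < ρ + σ t ∧ 0 < ρ - σ t := fun t ht => by
    constructor <;> simp only [hσ] <;> nlinarith [ht.1, ht.2]
  have habs : ∀ t ∈ Icc (0 : ℝ) 1, |σ t| < ρ := fun t ht =>
    abs_lt.2 ⟨by linarith [hmem t ht], by linarith [hmem t ht]⟩
  have hderiv : ∀ t, HasDerivAt σ (b - a) t := fun t => by
    simpa [hσ] using ((hasDerivAt_id t).const_mul (b - a)).const_add a
  have : Continuous σ := by fun_prop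
  have hpt : ∀ t, c + a • e + t • (b - a) • e = c + σ t • e := fun t => by
    simp only [hσ]; module
  have hseg : ∀ t ∈ Icc (0 : ℝ) 1, c + a • e + t • (b - a) • e ∈ Ω := fun t ht => hsub <| by
    rw [hpt, mem_ball_iff_norm, add_sub_cancel_left, norm_smul, he, mul_one]
    exact habs t ht
  have hmetric : ∀ t ∈ Icc (0 : ℝ) 1,
      kobayashiMetric Ω (c + a • e + t • (b - a) • e) ((b - a) • e) ≤
        1 / 2 * ((b - a) / (ρ + σ t) - -(b - a) / (ρ - σ t)) := fun t ht => by
    rw [hpt]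
    refine (kobayashiMetric_diameter_le _ he hsub (habs t ht)).trans_eq ?_
    rw [abs_of_nonneg (sub_nonneg.2 hab)]
    field_simp [(hmem t ht).1.ne', (hmem t ht).2.ne']
    ring
  have hle := kobayashiEDist_add_le_of_hasDerivAt hseg
    (g := fun t => 1 / 2 * (Real.log (ρ + σ t) - Real.log (ρ - σ t)))
    (fun t ht => ((((hderiv t).const_add ρ).log (hmem t ht).1.ne').sub
      (((hderiv t).const_sub ρ).log (hmem t ht).2.ne')).const_mul _)
    (continuousOn_const.mul
      ((continuousOn_const.div (by fun_prop) fun t ht => (hmem t ht).1.ne').sub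
        (continuousOn_const.div (by fun_prop) fun t ht => (hmem t ht).2.ne'))) hmetric
  rwa [show c + a • e + (b - a) • e = c + b • e by module, show σ 1 = b by simp [hσ],
    show σ 0 = a by simp [hσ]] at hle

theorem half_log_sub_half_log_le {R w s s' : ℝ} (hR : 0 < R) (hw : 0 < w) (hw8 : w ≤ 1 / 8)
    (hs : R * w / 4 ≤ s) (hss' : s ≤ s') (hs' : s' ≤ R * w) :
    1 / 2 * (Real.log (R * (1 - w ^ 2) + (R - s)) - Real.log (R * (1 - w ^ 2) - (R - s))) -
        1 / 2 * (Real.log (R * (1 - w ^ 2) + (R - s')) - Real.log (R * (1 - w ^ 2) - (R - s'))) ≤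
      1 / 2 * Real.log s' - 1 / 2 * Real.log s + 5 * w := by
  have hRw : 0 < R * w := mul_pos hR hw
  have hs₀ : 0 < s := by linarith
  have hRw2 : R * w ^ 2 ≤ 4 * w * s := by nlinarith
  have hRw8 : R * w ≤ R / 8 := by nlinarith
  have hfar : Real.log (R * (1 - w ^ 2) + (R - s)) ≤ Real.log (2 * R) :=
    Real.log_le_log (by nlinarith) (by nlinarith [sq_nonneg w])
  have hfar' : Real.log (2 * R) - 2 * w ≤ Real.log (R * (1 - w ^ 2) + (R - s')) := by
    have hle : Real.log (2 * R * (1 - w)) ≤ Real.log (R * (1 - w ^ 2) + (R - s')) :=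
      Real.log_le_log (mul_pos (by linarith) (by linarith)) (by nlinarith)
    rw [Real.log_mul (by linarith) (by linarith)] at hle
    linarith [neg_two_mul_le_log_one_sub hw.le (by linarith)]
  have hnear : Real.log s - 8 * w ≤ Real.log (R * (1 - w ^ 2) - (R - s)) := by
    have hle : Real.log (s * (1 - 4 * w)) ≤ Real.log (R * (1 - w ^ 2) - (R - s)) :=
      Real.log_le_log (mul_pos hs₀ (by linarith)) (by linarith)
    rw [Real.log_mul hs₀.ne' (by linarith)] at hle
    linarith [neg_two_mul_le_log_one_sub (x := 4 * w) (by linarith) (by linarith)]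
  have hnear' : Real.log (R * (1 - w ^ 2) - (R - s')) ≤ Real.log s' :=
    Real.log_le_log (by nlinarith) (by nlinarith [sq_nonneg w])
  linarith

section Inward

variable {p N : E} {R w s s' : ℝ}

theorem ball_sub_smul_subset (hN : ‖N‖ = 1) (hR : 0 < R) (hw : 0 < w) (hw8 : w ≤ 1 / 8)
    (hsub : Metric.ball (p - R • N) (R * (1 - w ^ 2)) ⊆ Ω) (hs : R * w / 4 ≤ s)
    (hs' : s ≤ R * w) : Metric.ball (p - s • N) (s / 2) ⊆ Ω := by
  refine (Metric.ball_subset_ball' ?_).trans hsub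
  have hdist : p - s • N - (p - R • N) = (R - s) • N := by module
  have hsR : s ≤ R := hs'.trans (mul_le_of_le_one_right hR.le (by linarith))
  have : 0 < s := (div_pos (mul_pos hR hw) four_pos).trans_le hs
  rw [dist_eq_norm, hdist, norm_smul, hN, mul_one, Real.norm_of_nonneg (by linarith)]
  nlinarith

theorem kobayashiEDist_sub_smul_le (hN : ‖N‖ = 1) (hR : 0 < R) (hw : 0 < w) (hw8 : w ≤ 1 / 8)
    (hsub : Metric.ball (p - R • N) (R * (1 - w ^ 2)) ⊆ Ω) (hs : R * w / 4 ≤ s)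
    (hss' : s ≤ s') (hs' : s' ≤ R * w) :
    kobayashiEDist Ω (p - s • N) (p - s' • N) ≤
      ENNReal.ofReal (1 / 2 * Real.log s' - 1 / 2 * Real.log s + 5 * w) := by
  have hcentre : ∀ t : ℝ, p - t • N = p - R • N + (R - t) • N := fun t => by module
  have hRw : 0 < R * w := mul_pos hR hw
  rw [kobayashiEDist_comm, hcentre s, hcentre s']
  exact (kobayashiEDist_diameter_le hN hsub (by nlinarith) (by linarith) (by nlinarith)).trans
    (ENNReal.ofReal_le_ofReal (half_log_sub_half_log_le hR hw hw8 hs hss' hs'))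

end Inward

theorem exists_mem_Icc_succ_of_tendsto_zero {a : ℕ → ℝ} (ha : Tendsto a atTop (𝓝 0)) {s : ℝ}
    (hs : 0 < s) (hs' : s ≤ a 0) : ∃ k, s ∈ Icc (a (k + 1)) (a k) := by
  classical
  have hex : ∃ k, a (k + 1) ≤ s :=
    (((tendsto_add_atTop_iff_nat 1).2 ha).eventually_le_const hs).exists
  refine ⟨Nat.find hex, Nat.find_spec hex, ?_⟩
  rcases hk : Nat.find hex with _ | k
  · exact hs'
  · exact (not_le.1 (Nat.find_min hex (hk ▸ k.lt_succ_self))).le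

theorem le_ofReal_sub_add_tsum {d : ℝ → ℝ → ℝ≥0∞} (htri : ∀ r s t, d r t ≤ d r s + d s t)
    {F : ℝ → ℝ} (hF : MonotoneOn F (Ioi 0)) {a c : ℕ → ℝ} (hpos : ∀ k, 0 < a k)
    (ha : Tendsto a atTop (𝓝 0)) (hc : ∀ k, 0 ≤ c k) (hsum : Summable c)
    (hstep : ∀ k s s', a (k + 1) ≤ s → s ≤ s' → s' ≤ a k →
      d s s' ≤ ENNReal.ofReal (F s' - F s + c k)) {s s' : ℝ} (hs : 0 < s) (hss' : s ≤ s')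
    (hs' : s' ≤ a 0) : d s s' ≤ ENNReal.ofReal (F s' - F s + ∑' k, c k) := by
  have hpartial : ∀ n s s', a (n + 1) ≤ s → s ≤ s' → s' ≤ a 0 →
      d s s' ≤ ENNReal.ofReal (F s' - F s + ∑ k ∈ Finset.range (n + 1), c k) := by
    intro n
    induction n with
    | zero => simpa using hstep 0
    | succ n ih =>
      intro s s' h₁ h₂ h₃
      have hsums : 0 ≤ ∑ k ∈ Finset.range (n + 1), c k := Finset.sum_nonneg fun k _ => hc k
      have hs₀ : 0 < s := (hpos _).trans_le h₁
      rw [Finset.sum_range_succ]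
      rcases le_total (a (n + 1)) s with h | h
      · exact (ih s s' h h₂ h₃).trans (ENNReal.ofReal_le_ofReal (by linarith [hc (n + 1)]))
      rcases le_total s' (a (n + 1)) with h' | h'
      · exact (hstep _ s s' h₁ h₂ h').trans (ENNReal.ofReal_le_ofReal (by linarith))
      have hlow : F s ≤ F (a (n + 1)) := hF hs₀ (hpos _) h
      have hupp : F (a (n + 1)) ≤ F s' := hF (hpos _) (hs₀.trans_le h₂) h'
      refine (htri s (a (n + 1)) s').trans ((add_le_add (hstep _ _ _ h₁ h le_rfl)
        (ih _ _ le_rfl h' h₃)).trans ?_)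
      rw [← ENNReal.ofReal_add (by linarith [hc (n + 1)]) (by linarith)]
      exact ENNReal.ofReal_le_ofReal (by linarith)
  obtain ⟨n, hn⟩ := (((tendsto_add_atTop_iff_nat 1).2 ha).eventually_le_const hs).exists
  have hle := hsum.sum_le_tsum (Finset.range (n + 1)) fun k _ => hc k
  exact (hpartial n s s' hn hss' hs').trans (ENNReal.ofReal_le_ofReal (by linarith))

/-- The estimate of the Kobayashi distance along a normal at the boundary point `p`: some closed
half-space with boundary point `p` and unit outer normal `N` contains `Ω`, and for `s ≤ s' ≤ s₀`
moving inwards along `N` from depth `s` to depth `s'` costs at most `½ log (s' / s) + C`. The ball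
condition says that the depth is comparable with the boundary distance. -/
def NormalEstimate (Ω : Set E) (C s₀ : ℝ) (p : E) : Prop :=
  ∃ N : E, ‖N‖ = 1 ∧ (∀ x ∈ Ω, (inner ℂ N (x - p)).re ≤ 0) ∧
    (∀ s, 0 < s → s ≤ s₀ → Metric.ball (p - s • N) (s / 2) ⊆ Ω) ∧
    ∀ s s', 0 < s → s ≤ s' → s' ≤ s₀ → kobayashiEDist Ω (p - s • N) (p - s' • N) ≤
      ENNReal.ofReal (1 / 2 * Real.log s' - 1 / 2 * Real.log s + C)

theorem NormalEstimate.mono {C C' s₀ s₀' : ℝ} {p : E} (h : NormalEstimate Ω C s₀ p) (hC : C ≤ C')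
    (hs : s₀' ≤ s₀) : NormalEstimate Ω C' s₀' p := by
  obtain ⟨N, hN, hsupp, hball, hest⟩ := h
  exact ⟨N, hN, hsupp, fun s h₁ h₂ => hball s h₁ (h₂.trans hs), fun s s' h₁ h₂ h₃ =>
    (hest s s' h₁ h₂ (h₃.trans hs)).trans (ENNReal.ofReal_le_ofReal (by linarith))⟩

theorem normalEstimate_of_forall_ball_subset {p N : E} (hN : ‖N‖ = 1)
    (hsupp : ∀ x ∈ Ω, (inner ℂ N (x - p)).re ≤ 0) {r : ℝ} (hr : 0 < r) {w : ℕ → ℝ}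
    (hw : ∀ k, 0 < w k) (hw8 : ∀ k, w k ≤ 1 / 8) (hsum : Summable w)
    (hhalf : ∀ k, w k / 2 ≤ w (k + 1))
    (hsub : ∀ k, Metric.ball (p - (r * (1 / 2) ^ k) • N) (r * (1 / 2) ^ k * (1 - w k ^ 2)) ⊆ Ω) :
    NormalEstimate Ω (∑' k, 5 * w k) (r * w 0) p := by
  have hR : ∀ k : ℕ, 0 < r * (1 / 2) ^ k := fun k => by positivity
  set a : ℕ → ℝ := fun k => r * (1 / 2) ^ k * w k with ha
  have hdecay : ∀ k, r * (1 / 2) ^ k * w k / 4 ≤ a (k + 1) := fun k => by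
    simp only [ha, pow_succ]
    nlinarith [mul_le_mul_of_nonneg_left (hhalf k) (hR k).le]
  have hlim : Tendsto a atTop (𝓝 0) := by
    simpa [ha] using
      (summable_geometric_two.tendsto_atTop_zero.const_mul r).mul hsum.tendsto_atTop_zero
  have hF : MonotoneOn (fun s : ℝ => 1 / 2 * Real.log s) (Ioi 0) :=
    fun _ hs _ _ hst => mul_le_mul_of_nonneg_left (Real.log_le_log hs hst) (by norm_num)
  have ha0 : r * w 0 = a 0 := by simp [ha]
  refine ⟨N, hN, hsupp, fun s hs hs' => ?_, fun s s' hs hss' hs' => ?_⟩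
  · obtain ⟨k, hk⟩ := exists_mem_Icc_succ_of_tendsto_zero hlim hs (hs'.trans_eq ha0)
    exact ball_sub_smul_subset hN (hR k) (hw k) (hw8 k) (hsub k) ((hdecay k).trans hk.1) hk.2
  · exact le_ofReal_sub_add_tsum (d := fun s s' => kobayashiEDist Ω (p - s • N) (p - s' • N))
      (fun _ _ _ => kobayashiEDist_triangle _ _ _ _) hF (fun k => mul_pos (hR k) (hw k)) hlim
      (fun k => mul_nonneg (by norm_num) (hw k).le) (hsum.mul_left 5)
      (fun k s s' h₁ h₂ h₃ => kobayashiEDist_sub_smul_le hN (hR k) (hw k) (hw8 k) (hsub k)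
        ((hdecay k).trans h₁) h₂ h₃) hs hss' (hs'.trans_eq ha0)

theorem exists_normalEstimate_nhds (hO : IsOpen Ω) (hC : Convex ℝ Ω) {p₀ : E}
    (hp₀ : IsDiniSmoothAt Ω p₀) :
    ∃ V ∈ 𝓝 p₀, ∃ C s₀ : ℝ, 0 < s₀ ∧ ∀ p ∈ frontier Ω ∩ V, NormalEstimate Ω C s₀ p := by
  obtain ⟨U, r, ν, hU, hpU, hr, hν, hinteg⟩ := hp₀
  obtain ⟨η, hη, hηU⟩ := Metric.isOpen_iff.1 hU p₀ hpU
  obtain ⟨w, hw, hwmod, hsum, hhalf⟩ := exists_summable_majorant_modulusOfContinuity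
    (fun q hq => (hν q hq).1) hinteg
  obtain ⟨k₀, hk₀⟩ := ((hsum.tendsto_atTop_zero.eventually_le_const
    (by norm_num : (0 : ℝ) < 1 / 8)).and
    (summable_geometric_two.tendsto_atTop_zero.eventually_le_const
      (half_pos hη))).exists_forall_of_atTop
  refine ⟨Metric.ball p₀ (η / 2), Metric.ball_mem_nhds _ (half_pos hη), ∑' k, 5 * w (k + k₀),
    1 / 2 * (1 / 2) ^ k₀ * w (0 + k₀), mul_pos (by positivity) (hw _), fun p hp => ?_⟩
  have hball : ∀ k, Metric.ball p ((1 / 2) ^ (k + k₀)) ⊆ U := fun k =>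
    (Metric.ball_subset_ball' (by
      linarith [(hk₀ (k + k₀) (Nat.le_add_left _ _)).2, Metric.mem_ball.1 hp.2])).trans hηU
  have hpU' : p ∈ frontier Ω ∩ U := ⟨hp.1, hball 0 (Metric.mem_ball_self (by positivity))⟩
  have hw8 : ∀ k, w (k + k₀) ≤ 1 / 8 := fun k => (hk₀ _ (Nat.le_add_left _ _)).1
  refine normalEstimate_of_forall_ball_subset (w := fun k => w (k + k₀)) (hν p hpU').1
    (fun x hx => re_inner_outerUnitNormal_nonpos hO hC hU hr hν hpU' hx) (by positivity)
    (fun k => hw _) hw8 ((summable_nat_add_iff k₀).2 hsum)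
    (fun k => by simpa only [add_right_comm k 1 k₀] using hhalf (k + k₀)) fun k => ?_
  rw [mul_assoc _ (_ ^ k₀), ← pow_add, add_comm k₀]
  exact ball_sub_smul_outerUnitNormal_subset hO hC hU hr hν hp.1 (hball k) (hwmod _)
    ((hw8 k).trans (by norm_num)) (by positivity) (by linarith)

theorem exists_normalEstimate [ProperSpace E] (hO : IsOpen Ω) (hC : Convex ℝ Ω)
    (hB : Bornology.IsBounded Ω) (hD : HasDiniSmoothBoundary Ω) :
    ∃ C s₀ : ℝ, 0 < s₀ ∧ ∀ p ∈ frontier Ω, NormalEstimate Ω C s₀ p := by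
  have hcomp : IsCompact (frontier Ω) := Metric.isCompact_of_isClosed_isBounded isClosed_frontier
    (hB.closure.subset frontier_subset_closure)
  refine hcomp.induction_on
    (p := fun S => ∃ C s₀ : ℝ, 0 < s₀ ∧ ∀ p ∈ S, NormalEstimate Ω C s₀ p) ?_ ?_ ?_ ?_
  · exact ⟨1, 1, one_pos, by simp⟩
  · rintro S T hST ⟨C, s₀, hs₀, h⟩
    exact ⟨C, s₀, hs₀, fun p hp => h p (hST hp)⟩
  · rintro S T ⟨C, s, hs, h⟩ ⟨C', s', hs', h'⟩
    refine ⟨max C C', min s s', lt_min hs hs', ?_⟩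
    rintro p (hp | hp)
    · exact (h p hp).mono (le_max_left _ _) (min_le_left _ _)
    · exact (h' p hp).mono (le_max_right _ _) (min_le_right _ _)
  · intro p hp
    obtain ⟨V, hV, C, s₀, hs₀, h⟩ := exists_normalEstimate_nhds hO hC (hD p hp)
    exact ⟨frontier Ω ∩ V, inter_mem_nhdsWithin _ hV, C, s₀, hs₀, h⟩

end NormalEstimate

section KobayashiDistUpperBound

variable {x p N : E} {δ : ℝ}

theorem eq_sub_smul_of_forall_ball_re_inner_nonpos (hN : ‖N‖ = 1) (hδ : 0 < δ) (hx : ‖x - p‖ = δ)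
    (hball : ∀ y ∈ Metric.ball x δ, (inner ℂ N (y - p)).re ≤ 0) : x = p - δ • N := by
  have hclosed : ∀ y ∈ Metric.closedBall x δ, (inner ℂ N (y - p)).re ≤ 0 := by
    rw [← closure_ball x hδ.ne']
    have hcont : Continuous fun y => (inner ℂ N (y - p)).re := by fun_prop
    exact closure_minimal hball (isClosed_le hcont continuous_const)
  have hNN : (inner ℂ N N).re = 1 := by
    rw [inner_self_eq_norm_sq_to_K, hN]
    norm_num
  have hfar : (inner ℂ N (x - p)).re ≤ -δ := by
    have h := hclosed (x + δ • N) (by simp [norm_smul, hN, abs_of_pos hδ])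
    rw [add_sub_right_comm, inner_add_right, Complex.add_re, re_inner_smul_right, hNN] at h
    linarith
  -- equality case of Cauchy–Schwarz
  have hnorm : ‖(x - p) + δ • N‖ ^ 2 ≤ 0 := by
    have hinner : RCLike.re (inner ℂ (x - p) (δ • N)) = δ * (inner ℂ N (x - p)).re := by
      rw [RCLike.re_eq_complex_re, re_inner_smul_right]
      exact congrArg (δ * ·) (inner_re_symm (𝕜 := ℂ) (x - p) N)
    rw [norm_add_sq (𝕜 := ℂ), hx, norm_smul, hN, Real.norm_of_nonneg hδ.le, hinner]
    nlinarith
  rw [eq_sub_iff_add_eq, ← sub_eq_zero, add_sub_right_comm]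
  exact norm_eq_zero.1 (pow_eq_zero_iff two_ne_zero |>.1 (hnorm.antisymm (sq_nonneg _)))

theorem NormalEstimate.exists_inward_point {C s₀ s : ℝ} (h : NormalEstimate Ω C s₀ p) (hδ : 0 < δ)
    (hx : ‖x - p‖ = δ) (hball : Metric.ball x δ ⊆ Ω) (hs : δ ≤ s) (hs₀ : s ≤ s₀) :
    ∃ x', ‖x - x'‖ = s - δ ∧ Metric.ball x' (s / 2) ⊆ Ω ∧
      kobayashiEDist Ω x x' ≤ ENNReal.ofReal (1 / 2 * Real.log s - 1 / 2 * Real.log δ + C) := by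
  obtain ⟨N, hN, hsupp, hinner, hest⟩ := h
  obtain rfl : x = p - δ • N :=
    eq_sub_smul_of_forall_ball_re_inner_nonpos hN hδ hx fun y hy => hsupp y (hball hy)
  refine ⟨p - s • N, ?_, hinner s (hδ.trans_le hs) hs₀, hest δ s hδ hs hs₀⟩
  rw [sub_sub_sub_cancel_left, ← sub_smul, norm_smul, hN, mul_one,
    Real.norm_of_nonneg (sub_nonneg.2 hs)]

theorem exists_inward_point [ProperSpace E] (hO : IsOpen Ω) (hC : Convex ℝ Ω)
    (hB : Bornology.IsBounded Ω) (hne : (frontier Ω).Nonempty) (hD : HasDiniSmoothBoundary Ω) :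
    ∃ C s₀ : ℝ, 0 ≤ C ∧ 0 < s₀ ∧ ∀ x ∈ Ω, ∀ s, 0 < s → s ≤ s₀ → ∃ x', ‖x - x'‖ ≤ s ∧
      Metric.ball x' (s / 2) ⊆ Ω ∧
      kobayashiEDist Ω x x' ≤ ENNReal.ofReal (1 / 2 * Real.log (1 + s / bdryDist Ω x) + C) := by
  obtain ⟨C, s₀, hs₀, hest⟩ := exists_normalEstimate hO hC hB hD
  refine ⟨|C|, s₀, abs_nonneg C, hs₀, fun x hx s hs hss₀ => ?_⟩
  have hδ := bdryDist_pos hO hne hx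
  have hball := ball_bdryDist_subset hO hx
  rcases le_or_gt s (bdryDist Ω x) with hle | hlt
  · refine ⟨x, by simpa using hs.le, (Metric.ball_subset_ball (by linarith)).trans hball, ?_⟩
    simp [kobayashiEDist_self hO hC hx]
  · obtain ⟨p, hp, hdist⟩ := isClosed_frontier.exists_infDist_eq_dist hne x
    obtain ⟨x', hxx', hball', hcost⟩ := (hest p hp).exists_inward_point hδ
      (by rw [bdryDist, hdist, dist_eq_norm]) hball hlt.le hss₀
    refine ⟨x', by linarith, hball', hcost.trans (ENNReal.ofReal_le_ofReal ?_)⟩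
    have hlog : Real.log (s / bdryDist Ω x) ≤ Real.log (1 + s / bdryDist Ω x) :=
      Real.log_le_log (by positivity) (by linarith)
    rw [Real.log_div hs.ne' hδ.ne'] at hlog
    linarith [le_abs_self C]

theorem kobayashiDist_le_of_inward_points {y x' y' : E} {A s α β : ℝ} (hC : Convex ℝ Ω) (hs : 0 < s)
    (hxy : ‖x - y‖ ≤ A * s) (hxx' : ‖x - x'‖ ≤ s) (hyy' : ‖y - y'‖ ≤ s)
    (hballx : Metric.ball x' (s / 2) ⊆ Ω) (hbally : Metric.ball y' (s / 2) ⊆ Ω)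
    (hα : 0 ≤ α) (hβ : 0 ≤ β) (hcostx : kobayashiEDist Ω x x' ≤ ENNReal.ofReal α)
    (hcosty : kobayashiEDist Ω y y' ≤ ENNReal.ofReal β) :
    kobayashiDist Ω x y ≤ α + (4 + 2 * A) + β := by
  have hA : 0 ≤ A := nonneg_of_mul_nonneg_left ((norm_nonneg _).trans hxy) hs
  have hmid : kobayashiEDist Ω x' y' ≤ ENNReal.ofReal (4 + 2 * A) := by
    refine (kobayashiEDist_le_norm_div hC (half_pos hs) hballx hbally).trans
      (ENNReal.ofReal_le_ofReal ((div_le_iff₀ (half_pos hs)).2 ?_))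
    have htri : ‖y' - x'‖ ≤ ‖y - y'‖ + ‖x - y‖ + ‖x - x'‖ := by
      rw [show y' - x' = -(y - y') + -(x - y) + (x - x') by abel]
      simpa only [norm_neg] using norm_add₃_le (a := -(y - y')) (b := -(x - y)) (c := x - x')
    linarith
  refine ENNReal.toReal_le_of_le_ofReal (by positivity) ?_
  calc kobayashiEDist Ω x y
      ≤ kobayashiEDist Ω x x' + kobayashiEDist Ω x' y' + kobayashiEDist Ω y' y :=
        (kobayashiEDist_triangle Ω x y' y).trans
          (add_le_add_left (kobayashiEDist_triangle Ω x x' y') _)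
    _ ≤ ENNReal.ofReal α + ENNReal.ofReal (4 + 2 * A) + ENNReal.ofReal β :=
        add_le_add (add_le_add hcostx hmid) ((kobayashiEDist_comm Ω y' y).trans_le hcosty)
    _ = ENNReal.ofReal (α + (4 + 2 * A) + β) := by
        rw [ENNReal.ofReal_add (by positivity) hβ, ENNReal.ofReal_add hα (by positivity)]

theorem exists_kobayashiDist_le [ProperSpace E] (hO : IsOpen Ω) (hC : Convex ℝ Ω)
    (hB : Bornology.IsBounded Ω) (hne : (frontier Ω).Nonempty) (hD : HasDiniSmoothBoundary Ω) :
    ∃ C : ℝ, 0 ≤ C ∧ ∀ x ∈ Ω, ∀ y ∈ Ω, x ≠ y →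
      kobayashiDist Ω x y ≤ 1 / 2 * Real.log (1 + ‖x - y‖ / bdryDist Ω x) +
        1 / 2 * Real.log (1 + ‖x - y‖ / bdryDist Ω y) + C := by
  obtain ⟨B, hB₀, hdiam⟩ : ∃ B, 0 ≤ B ∧ ∀ x ∈ Ω, ∀ y ∈ Ω, ‖x - y‖ ≤ B :=
    ⟨Metric.diam Ω, Metric.diam_nonneg, fun x hx y hy => by
      simpa [dist_eq_norm] using Metric.dist_le_diam_of_mem hB hx hy⟩
  obtain ⟨C, s₀, hC₀, hs₀, hinward⟩ := exists_inward_point hO hC hB hne hD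
  refine ⟨C + (4 + 2 * (1 + B / s₀)) + C, by positivity, fun x hx y hy hxy => ?_⟩
  have hd : 0 < ‖x - y‖ := norm_pos_iff.2 (sub_ne_zero.2 hxy)
  have hcost : ∀ z ∈ Ω, 0 ≤ 1 / 2 * Real.log (1 + ‖x - y‖ / bdryDist Ω z) + C := fun z hz => by
    have hδ := bdryDist_pos hO hne hz
    have hlog : 0 ≤ Real.log (1 + ‖x - y‖ / bdryDist Ω z) :=
      Real.log_nonneg (le_add_of_nonneg_right (by positivity))
    positivity
  -- both points are moved inward to a scale comparable with their distance
  set s := min ‖x - y‖ s₀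
  have hs : 0 < s := lt_min hd hs₀
  have hds : ‖x - y‖ ≤ (1 + B / s₀) * s := by
    rw [one_add_mul]
    rcases min_choice ‖x - y‖ s₀ with heq | heq <;> simp only [s, heq]
    · exact le_add_of_nonneg_right (by positivity)
    · rw [div_mul_cancel₀ _ hs₀.ne']
      linarith [hdiam x hx y hy]
  have hpush : ∀ z ∈ Ω, ∃ z', ‖z - z'‖ ≤ s ∧ Metric.ball z' (s / 2) ⊆ Ω ∧ kobayashiEDist Ω z z' ≤
      ENNReal.ofReal (1 / 2 * Real.log (1 + ‖x - y‖ / bdryDist Ω z) + C) := fun z hz => by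
    have hδ := bdryDist_pos hO hne hz
    obtain ⟨z', hzz', hball, hcost⟩ := hinward z hz s hs (min_le_right _ _)
    refine ⟨z', hzz', hball, hcost.trans (ENNReal.ofReal_le_ofReal ?_)⟩
    gcongr
    exact min_le_left _ _
  obtain ⟨x', hxx', hballx, hcostx⟩ := hpush x hx
  obtain ⟨y', hyy', hbally, hcosty⟩ := hpush y hy
  linarith [kobayashiDist_le_of_inward_points hC hs hds hxx' hyy' hballx hbally (hcost x hx)
    (hcost y hy) hcostx hcosty]

end KobayashiDistUpperBound

section QuasiGeodesicStability

variable {X : Type*} {D : X → X → ℝ} {S : Set X} {δ : ℝ} {x y p q : X}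

/-- `D` is a Gromov hyperbolic distance on `S`, hyperbolicity being expressed by the four-point
condition. Positivity of `D` off the diagonal is not required. -/
structure IsGromovHyperbolicOn (D : X → X → ℝ) (S : Set X) (δ : ℝ) : Prop where
  comm : ∀ x ∈ S, ∀ y ∈ S, D x y = D y x
  triangle : ∀ x ∈ S, ∀ y ∈ S, ∀ z ∈ S, D x z ≤ D x y + D y z
  four_point : ∀ x ∈ S, ∀ y ∈ S, ∀ z ∈ S, ∀ w ∈ S,
    D x y + D z w ≤ max (D x z + D y w) (D x w + D y z) + 2 * δ

/-- The Gromov product `(x|y)_p` with respect to `D`, as a function of the base point `p`; it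
measures the distance from `p` to a geodesic `[x, y]`. -/
noncomputable def basedProduct (D : X → X → ℝ) (x y p : X) : ℝ := (D x p + D p y - D x y) / 2

/-- The signed position of `p` along `[x, y]`, measured from the midpoint: the second coordinate
of `p` besides `basedProduct D x y p`. -/
noncomputable def axialCoordinate (D : X → X → ℝ) (x y p : X) : ℝ := (D x p - D p y) / 2

theorem basedProduct_left (D : X → X → ℝ) (x y : X) : basedProduct D x y x = D x x / 2 := by
  rw [basedProduct, add_sub_cancel_right]

theorem basedProduct_right (D : X → X → ℝ) (x y : X) : basedProduct D x y y = D y y / 2 := by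
  rw [basedProduct, add_sub_cancel_left]

namespace IsGromovHyperbolicOn

theorem basedProduct_le_add (hD : IsGromovHyperbolicOn D S δ) (hx : x ∈ S) (hy : y ∈ S)
    (hp : p ∈ S) (hq : q ∈ S) : basedProduct D x y q ≤ basedProduct D x y p + D q p := by
  have hxq := hD.triangle x hx p hp q hq
  have hqy := hD.triangle q hq p hp y hy
  rw [hD.comm p hp q hq] at hxq
  unfold basedProduct
  linarith

theorem le_basedProduct_add (hD : IsGromovHyperbolicOn D S δ) (hx : x ∈ S) (hy : y ∈ S)
    (hp : p ∈ S) (hq : q ∈ S) :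
    D p q ≤ basedProduct D x y p + basedProduct D x y q +
      |axialCoordinate D x y p - axialCoordinate D x y q| + 2 * δ := by
  have h := hD.four_point p hp q hq x hx y hy
  rw [hD.comm p hp x hx, hD.comm q hq x hx] at h
  have hle := le_abs_self (axialCoordinate D x y p - axialCoordinate D x y q)
  have hge := neg_le_abs (axialCoordinate D x y p - axialCoordinate D x y q)
  unfold basedProduct axialCoordinate at *
  rcases max_cases (D x p + D q y) (D p y + D x q) with ⟨heq, -⟩ | ⟨heq, -⟩ <;> linarith

theorem abs_axialCoordinate_sub_le (hD : IsGromovHyperbolicOn D S δ) (hx : x ∈ S) (hy : y ∈ S)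
    (hp : p ∈ S) (hq : q ∈ S)
    (hfar : D p q + δ ≤ basedProduct D x y p + basedProduct D x y q) :
    |axialCoordinate D x y p - axialCoordinate D x y q| ≤ δ := by
  have hpq := hD.four_point x hx p hp q hq y hy
  have hqp := hD.four_point x hx q hq p hp y hy
  rw [hD.comm q hq p hp] at hqp
  unfold basedProduct axialCoordinate at *
  rw [abs_sub_le_iff]
  constructor
  · rcases max_cases (D x q + D p y) (D x y + D p q) with ⟨heq, -⟩ | ⟨heq, -⟩ <;> linarith
  · rcases max_cases (D x p + D q y) (D x y + D p q) with ⟨heq, -⟩ | ⟨heq, -⟩ <;> linarith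

end IsGromovHyperbolicOn

theorem abs_sub_le_of_forall_step_le {u : ℝ → ℝ} {τ a b : ℝ} (hτ : 0 < τ) (hδ : 0 ≤ δ)
    (hab : a ≤ b)
    (hstep : ∀ s ∈ Icc a b, ∀ t ∈ Icc a b, s ≤ t → t - s ≤ τ → |u s - u t| ≤ δ) :
    |u a - u b| ≤ ((b - a) / τ + 1) * δ := by
  have hchain : ∀ n : ℕ, ∀ t ∈ Icc a b, t - a ≤ n * τ → |u a - u t| ≤ n * δ := by
    intro n
    induction n with
    | zero =>
      intro t ht hle
      obtain rfl : t = a := le_antisymm (by simpa using hle) ht.1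
      simp
    | succ n ih =>
      intro t ht hle
      push_cast at hle ⊢
      have hs : max a (t - τ) ∈ Icc a b := ⟨le_max_left _ _, max_le hab (by linarith [ht.2])⟩
      have hprev := ih _ hs (by
        rw [sub_le_iff_le_add]
        exact max_le (le_add_of_nonneg_left (by positivity)) (by linarith))
      have hlast := hstep _ hs t ht (max_le ht.1 (by linarith))
        (by linarith [le_max_right a (t - τ)])
      linarith [abs_sub_le (u a) (u (max a (t - τ))) (u t)]
  refine (hchain ⌈(b - a) / τ⌉₊ b (right_mem_Icc.2 hab) ?_).trans ?_
  · exact (div_le_iff₀ hτ).1 (Nat.le_ceil _)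
  · gcongr
    exact (Nat.ceil_lt_add_one (div_nonneg (sub_nonneg.2 hab) hτ.le)).le

theorem exists_eq_and_forall_Icc_ge {h : ℝ → ℝ} {a t c : ℝ} (hat : a ≤ t)
    (hcont : ContinuousOn h (Icc a t)) (ha : h a ≤ c) (ht : c ≤ h t) :
    ∃ s ∈ Icc a t, h s = c ∧ ∀ r ∈ Icc s t, c ≤ h r := by
  obtain ⟨s, ⟨hs, hsc⟩, hmax⟩ := (isCompact_Icc.of_isClosed_subset
    (hcont.preimage_isClosed_of_isClosed isClosed_Icc (isClosed_singleton (x := c)))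
    inter_subset_left).exists_isGreatest (intermediate_value_Icc hat hcont ⟨ha, ht⟩)
  refine ⟨s, hs, hsc, fun r hr => ?_⟩
  by_contra! hlt
  have har := hs.1.trans hr.1
  obtain ⟨r', hr', hr'c⟩ := intermediate_value_Icc hr.2
    (hcont.mono (Icc_subset_Icc_left har)) ⟨hlt.le, ht⟩
  have hr's : r' ≤ s := hmax ⟨⟨har.trans hr'.1, hr'.2⟩, hr'c⟩
  obtain rfl : r' = r := le_antisymm (hr's.trans hr.1) hr'.1
  exact hlt.ne hr'c

theorem exists_excursion {h : ℝ → ℝ} {a b t c : ℝ} (ht : t ∈ Icc a b)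
    (hcont : ContinuousOn h (Icc a b)) (ha : h a ≤ c) (hb : h b ≤ c) (htc : c ≤ h t) :
    ∃ s₁ ∈ Icc a t, ∃ s₂ ∈ Icc t b, h s₁ = c ∧ h s₂ = c ∧ ∀ r ∈ Icc s₁ s₂, c ≤ h r := by
  obtain ⟨s₁, hs₁, hs₁c, hleft⟩ := exists_eq_and_forall_Icc_ge ht.1
    (hcont.mono (Icc_subset_Icc_right ht.2)) ha htc
  obtain ⟨s₂, hs₂, hs₂c, hright⟩ := exists_eq_and_forall_Icc_ge (h := fun r => h (-r))
    (neg_le_neg ht.2)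
    (hcont.comp continuousOn_neg fun r hr => ⟨by linarith [hr.2, ht.1], by linarith [hr.1]⟩)
    (by simpa using hb) (by simpa using htc)
  refine ⟨s₁, hs₁, -s₂, ⟨by linarith [hs₂.2], by linarith [hs₂.1]⟩, hs₁c, hs₂c, fun r hr => ?_⟩
  rcases le_total r t with hrt | htr
  · exact hleft r ⟨hr.1, hrt⟩
  · simpa using hright (-r) ⟨by linarith [hr.2], by linarith⟩

theorem excursion_length_le {γ : ℝ → X} {lam s₁ s₂ : ℝ} (hD : IsGromovHyperbolicOn D S δ)
    (hδ : 0 < δ) (hlam : 1 ≤ lam) (hx : x ∈ S) (hy : y ∈ S) (hs : s₁ ≤ s₂)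
    (hγ : MapsTo γ (Icc s₁ s₂) S)
    (hlower : lam⁻¹ * (s₂ - s₁) ≤ D (γ s₁) (γ s₂))
    (hupper : ∀ s ∈ Icc s₁ s₂, ∀ t ∈ Icc s₁ s₂, D (γ s) (γ t) ≤ lam * |s - t|)
    (hs₁ : basedProduct D x y (γ s₁) = 2 * lam ^ 2 * δ)
    (hs₂ : basedProduct D x y (γ s₂) = 2 * lam ^ 2 * δ)
    (hfar : ∀ s ∈ Icc s₁ s₂, 2 * lam ^ 2 * δ ≤ basedProduct D x y (γ s)) :
    s₂ - s₁ ≤ 2 * lam * (4 * lam ^ 2 + 3) * δ := by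
  have : 0 < lam := one_pos.trans_le hlam
  -- far from `[x, y]` the axial coordinate varies by at most `δ` over parameter steps `2 * lam * δ`
  have haxial : |axialCoordinate D x y (γ s₁) - axialCoordinate D x y (γ s₂)| ≤
      ((s₂ - s₁) / (2 * lam * δ) + 1) * δ := by
    refine abs_sub_le_of_forall_step_le (u := fun s => axialCoordinate D x y (γ s))
      (by positivity) hδ.le hs fun s hs t ht hst hstep => ?_
    refine hD.abs_axialCoordinate_sub_le hx hy (hγ hs) (hγ ht) ?_
    have hdist : D (γ s) (γ t) ≤ lam * (2 * lam * δ) := by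
      refine (hupper s hs t ht).trans ?_
      rw [abs_sub_comm, abs_of_nonneg (sub_nonneg.2 hst)]
      gcongr
    nlinarith [hfar s hs, hfar t ht, one_le_pow₀ hlam (n := 2)]
  have hdist := hD.le_basedProduct_add hx hy (hγ (left_mem_Icc.2 hs)) (hγ (right_mem_Icc.2 hs))
  have hhalf : (s₂ - s₁) / (2 * lam) ≤ (4 * lam ^ 2 + 3) * δ := by
    have haxial' : (s₂ - s₁) / (2 * lam * δ) * δ = (s₂ - s₁) / (2 * lam) := by field_simp
    have hlower' : lam⁻¹ * (s₂ - s₁) = 2 * ((s₂ - s₁) / (2 * lam)) := by field_simp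
    linarith
  rw [div_le_iff₀ (by positivity)] at hhalf
  linarith

theorem quasiGeodesic_stability {γ : ℝ → X} {lam a b t : ℝ} (hD : IsGromovHyperbolicOn D S δ)
    (hδ : 0 < δ) (hlam : 1 ≤ lam) (hγ : MapsTo γ (Icc a b) S)
    (hlower : ∀ s ∈ Icc a b, ∀ t ∈ Icc a b, lam⁻¹ * |s - t| ≤ D (γ s) (γ t))
    (hupper : ∀ s ∈ Icc a b, ∀ t ∈ Icc a b, D (γ s) (γ t) ≤ lam * |s - t|) (ht : t ∈ Icc a b) :
    basedProduct D (γ a) (γ b) (γ t) ≤ 2 * lam ^ 2 * (4 * lam ^ 2 + 4) * δ := by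
  have hlam₀ : 0 < lam := one_pos.trans_le hlam
  have ha : a ∈ Icc a b := left_mem_Icc.2 (ht.1.trans ht.2)
  have hb : b ∈ Icc a b := right_mem_Icc.2 (ht.1.trans ht.2)
  set h : ℝ → ℝ := fun s => basedProduct D (γ a) (γ b) (γ s)
  have hlip : ∀ s ∈ Icc a b, ∀ t ∈ Icc a b, h s ≤ h t + lam * |s - t| := fun s hs t ht =>
    (hD.basedProduct_le_add (hγ ha) (hγ hb) (hγ ht) (hγ hs)).trans
      (add_le_add_right (hupper s hs t ht) _)
  rcases le_total (h t) (2 * lam ^ 2 * δ) with hle | hge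
  · refine hle.trans (mul_le_mul_of_nonneg_right ?_ hδ.le)
    exact le_mul_of_one_le_right (by positivity) (by nlinarith)
  have hcont : ContinuousOn h (Icc a b) :=
    (LipschitzOnWith.of_le_add_mul ⟨lam, hlam₀.le⟩ hlip).continuousOn
  have hself : ∀ s ∈ Icc a b, D (γ s) (γ s) / 2 ≤ 2 * lam ^ 2 * δ := fun s hs => by
    have hnonpos : D (γ s) (γ s) ≤ 0 := by simpa using hupper s hs s hs
    exact (div_nonpos_of_nonpos_of_nonneg hnonpos two_pos.le).trans (by positivity)
  obtain ⟨s₁, hs₁, s₂, hs₂, hs₁h, hs₂h, hfar⟩ := exists_excursion ht hcont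
    ((basedProduct_left D _ _).trans_le (hself a ha))
    ((basedProduct_right D _ _).trans_le (hself b hb)) hge
  have hsub : Icc s₁ s₂ ⊆ Icc a b := Icc_subset_Icc hs₁.1 hs₂.2
  have hs : s₁ ≤ s₂ := hs₁.2.trans hs₂.1
  have hs₁' := hsub (left_mem_Icc.2 hs)
  have hs₂' := hsub (right_mem_Icc.2 hs)
  have hlen := excursion_length_le hD hδ hlam (hγ ha) (hγ hb) hs (hγ.mono_left hsub)
    (by simpa [abs_sub_comm s₁, abs_of_nonneg (sub_nonneg.2 hs)] using hlower s₁ hs₁' s₂ hs₂')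
    (fun s hs t ht => hupper s (hsub hs) t (hsub ht)) hs₁h hs₂h hfar
  calc h t ≤ h s₁ + lam * (t - s₁) := by
        simpa [abs_of_nonneg (sub_nonneg.2 hs₁.2)] using hlip t ht s₁ hs₁'
    _ ≤ 2 * lam ^ 2 * δ + lam * (2 * lam * (4 * lam ^ 2 + 3) * δ) := by
        rw [hs₁h]
        gcongr
        linarith [hs₂.1]
    _ = 2 * lam ^ 2 * (4 * lam ^ 2 + 4) * δ := by ring

end QuasiGeodesicStability

section CurveLength

variable {X : Type*} [PseudoMetricSpace X] {γ : ℝ → X} {a b c K τ : ℝ}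

theorem dist_le_sub_of_forall_step_le {G : ℝ → ℝ} (hτ : 0 < τ)
    (hstep : ∀ s ∈ Icc a b, ∀ t ∈ Icc a b, s ≤ t → t - s ≤ τ → dist (γ s) (γ t) ≤ G t - G s)
    {s t : ℝ} (hs : s ∈ Icc a b) (ht : t ∈ Icc a b) (hst : s ≤ t) :
    dist (γ s) (γ t) ≤ G t - G s := by
  have hchain : ∀ n : ℕ, ∀ t ∈ Icc a b, s ≤ t → t - s ≤ n * τ → dist (γ s) (γ t) ≤ G t - G s := by
    intro n
    induction n with
    | zero =>
      intro t ht hst hle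
      exact hstep s hs t ht hst (hle.trans (by simpa using hτ.le))
    | succ n ih =>
      intro t ht hst hle
      push_cast at hle
      rcases le_or_gt (t - s) τ with hshort | hlong
      · exact hstep s hs t ht hst hshort
      · have hr : t - τ ∈ Icc a b := ⟨by linarith [hs.1], by linarith [ht.2]⟩
        have hprev := ih (t - τ) hr (by linarith) (by linarith)
        have hlast := hstep (t - τ) hr t ht (by linarith) (by linarith)
        linarith [dist_triangle (γ s) (γ (t - τ)) (γ t)]
  exact hchain ⌈(t - s) / τ⌉₊ t ht hst ((div_le_iff₀ hτ).1 (Nat.le_ceil _))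

theorem eVariationOn_le_of_forall_step_le {G : ℝ → ℝ} (hτ : 0 < τ) (hab : a ≤ b)
    (hstep : ∀ s ∈ Icc a b, ∀ t ∈ Icc a b, s ≤ t → t - s ≤ τ → dist (γ s) (γ t) ≤ G t - G s) :
    eVariationOn γ (Icc a b) ≤ ENNReal.ofReal (G b - G a) := by
  have hdist : ∀ s ∈ Icc a b, ∀ t ∈ Icc a b, s ≤ t → dist (γ s) (γ t) ≤ G t - G s :=
    fun s hs t ht => dist_le_sub_of_forall_step_le hτ hstep hs ht
  have hmono : MonotoneOn G (Icc a b) := fun s hs t ht hst =>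
    sub_nonneg.1 (dist_nonneg.trans (hdist s hs t ht hst))
  have hG := hmono.eVariationOn_eq (left_mem_Icc.2 hab) (right_mem_Icc.2 hab)
  rw [inter_self] at hG
  rw [← hG]
  refine iSup_le fun p => (Finset.sum_le_sum fun i _ => ?_).trans
    (eVariationOn.sum_le (f := G) (n := p.1) p.2.2.1 p.2.2.2)
  rw [edist_comm, edist_comm (G _), edist_dist, edist_dist, Real.dist_eq, abs_sub_comm]
  exact ENNReal.ofReal_le_ofReal
    ((hdist _ (p.2.2.2 i) _ (p.2.2.2 (i + 1)) (p.2.2.1 i.le_succ)).trans (le_abs_self _))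

theorem eVariationOn_le_of_exp_growth (hτ : 0 < τ) (hc : 0 < c) (hK : 0 ≤ K) (hab : a ≤ b)
    (hstep : ∀ s ∈ Icc a b, ∀ t ∈ Icc a b, s ≤ t → t - s ≤ τ →
      dist (γ s) (γ t) ≤ K * Real.exp (c * (s - b)) * (t - s)) :
    eVariationOn γ (Icc a b) ≤ ENNReal.ofReal (K / c) := by
  refine (eVariationOn_le_of_forall_step_le (G := fun t => K / c * Real.exp (c * (t - b))) hτ hab
    fun s hs t ht hst hle => (hstep s hs t ht hst hle).trans ?_).trans
    (ENNReal.ofReal_le_ofReal ?_)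
  · have htangent : c * (t - s) ≤ Real.exp (c * (t - s)) - 1 := by
      linarith [Real.add_one_le_exp (c * (t - s))]
    calc K * Real.exp (c * (s - b)) * (t - s)
        = K / c * Real.exp (c * (s - b)) * (c * (t - s)) := by field_simp
      _ ≤ K / c * Real.exp (c * (s - b)) * (Real.exp (c * (t - s)) - 1) := by gcongr
      _ = K / c * (Real.exp (c * (s - b)) * Real.exp (c * (t - s))) -
          K / c * Real.exp (c * (s - b)) := by ring
      _ = K / c * Real.exp (c * (t - b)) - K / c * Real.exp (c * (s - b)) := by
        rw [← Real.exp_add]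
        ring_nf
  · rw [sub_self, mul_zero, Real.exp_zero, mul_one]
    exact sub_le_self _ (by positivity)

theorem eVariationOn_le_of_exp_decay {t₀ : ℝ} (hτ : 0 < τ) (hc : 0 < c) (hK : 0 ≤ K)
    (ht₀ : t₀ ∈ Icc a b)
    (hstep : ∀ s ∈ Icc a b, ∀ t ∈ Icc a b, |s - t| ≤ τ →
      dist (γ s) (γ t) ≤ K * Real.exp (-(c * |s - t₀|)) * |s - t|) :
    eVariationOn γ (Icc a b) ≤ ENNReal.ofReal (2 * K / c) := by
  have hleft : eVariationOn γ (Icc a t₀) ≤ ENNReal.ofReal (K / c) := by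
    refine eVariationOn_le_of_exp_growth hτ hc hK ht₀.1 fun s hs t ht hst hle => ?_
    have h := hstep s ⟨hs.1, hs.2.trans ht₀.2⟩ t ⟨ht.1, ht.2.trans ht₀.2⟩
      (by rwa [abs_sub_comm, abs_of_nonneg (sub_nonneg.2 hst)])
    rwa [abs_of_nonpos (sub_nonpos.2 hs.2), abs_sub_comm s t, abs_of_nonneg (sub_nonneg.2 hst),
      mul_neg, neg_neg] at h
  have hright : eVariationOn γ (Icc t₀ b) ≤ ENNReal.ofReal (K / c) := by
    have hreverse := eVariationOn.comp_eq_of_antitoneOn γ (fun t : ℝ => -t)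
      (t := Icc (-b) (-t₀)) fun _ _ _ _ hst => neg_le_neg hst
    rw [image_neg_Icc, neg_neg, neg_neg] at hreverse
    rw [← hreverse]
    refine eVariationOn_le_of_exp_growth hτ hc hK (neg_le_neg ht₀.2) fun s hs t ht hst hle => ?_
    have h := hstep (-s) ⟨by linarith [hs.2, ht₀.1], by linarith [hs.1]⟩ (-t)
      ⟨by linarith [ht.2, ht₀.1], by linarith [ht.1]⟩
      (by rwa [neg_sub_neg, abs_of_nonneg (sub_nonneg.2 hst)])
    rwa [abs_of_nonneg (by linarith [hs.2] : 0 ≤ -s - t₀), neg_sub_neg,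
      abs_of_nonneg (sub_nonneg.2 hst), ← mul_neg, neg_sub, sub_neg_eq_add, add_comm t₀,
      ← sub_neg_eq_add] at h
  have hsplit := eVariationOn.Icc_add_Icc γ ht₀.1 ht₀.2 ht₀
  rw [inter_eq_right.2 (Icc_subset_Icc_right ht₀.2), inter_eq_right.2 (Icc_subset_Icc_left ht₀.1),
    inter_self] at hsplit
  calc eVariationOn γ (Icc a b) ≤ ENNReal.ofReal (K / c) + ENNReal.ofReal (K / c) :=
        hsplit.symm.trans_le (add_le_add hleft hright)
    _ = ENNReal.ofReal (2 * K / c) := by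
      rw [← ENNReal.ofReal_add (by positivity) (by positivity)]
      ring_nf

end CurveLength

theorem exp_sub_one_le_mul_exp (u : ℝ) : Real.exp u - 1 ≤ u * Real.exp u := by
  have h := mul_le_mul_of_nonneg_right (Real.one_sub_le_exp_neg u) (Real.exp_pos u).le
  rw [← Real.exp_add, neg_add_cancel, Real.exp_zero] at h
  linarith

theorem IsBoundedMConvex.frontier_nonempty [Nontrivial E] {m : ℝ} (h : IsBoundedMConvex m Ω) :
    (frontier Ω).Nonempty := by
  refine nonempty_frontier_iff.2 ⟨h.nonempty, ?_⟩
  rintro rfl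
  exact NormedSpace.unbounded_univ ℝ E h.bounded

theorem IsBoundedMConvex.exists_norm_sub_le [ProperSpace E] {m : ℝ} (h : IsBoundedMConvex m Ω) :
    ∃ C : ℝ, 0 < C ∧ ∀ z ∈ Ω, ∀ w ∈ Ω, ∀ ρ M : ℝ, bdryDist Ω z ≤ ρ → kobayashiDist Ω z w ≤ M →
      ‖w - z‖ ≤ C * Real.exp (2 * M) * ρ ^ (1 / m) * kobayashiDist Ω z w := by
  obtain ⟨C, hC₀, hC⟩ := h.exists_bound
  have hm : 0 ≤ 1 / m := (one_div_pos.2 (one_pos.trans h.one_lt)).le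
  refine ⟨2 * C, by positivity, fun z hz w hw ρ M hρ hM => ?_⟩
  have hδ : 0 ≤ bdryDist Ω z := Metric.infDist_nonneg
  have hρ₀ : 0 ≤ ρ := hδ.trans hρ
  have hd := kobayashiDist_nonneg Ω z w
  rcases eq_or_ne (w - z) 0 with hzw | hzw
  · rw [hzw, norm_zero]
    positivity
  have hexp : Real.exp (2 * kobayashiDist Ω z w) - 1 ≤
      2 * kobayashiDist Ω z w * Real.exp (2 * M) :=
    (exp_sub_one_le_mul_exp _).trans (by gcongr)
  have hexp₀ : 0 ≤ Real.exp (2 * kobayashiDist Ω z w) - 1 :=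
    sub_nonneg.2 (Real.one_le_exp (by positivity))
  calc ‖w - z‖ ≤ bdryDistDir Ω z (w - z) * (Real.exp (2 * kobayashiDist Ω z w) - 1) :=
        norm_sub_le_bdryDistDir_mul h.isOpen h.convex h.bounded hz hw hzw
    _ ≤ C * bdryDist Ω z ^ (1 / m) * (Real.exp (2 * kobayashiDist Ω z w) - 1) := by
        gcongr
        exact hC z hz _ hzw
    _ ≤ C * ρ ^ (1 / m) * (2 * kobayashiDist Ω z w * Real.exp (2 * M)) := by gcongr
    _ = 2 * C * Real.exp (2 * M) * ρ ^ (1 / m) * kobayashiDist Ω z w := by ring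

section QuasiGeodesicLength

variable {lam a b : ℝ} {γ : ℝ → E} {x y z : E}

theorem IsKobayashiQuasiGeodesic.source_mem (hγ : IsKobayashiQuasiGeodesic Ω lam x y a b γ) :
    x ∈ Ω :=
  hγ.source ▸ hγ.mapsTo (left_mem_Icc.2 hγ.le)

theorem IsKobayashiQuasiGeodesic.target_mem (hγ : IsKobayashiQuasiGeodesic Ω lam x y a b γ) :
    y ∈ Ω :=
  hγ.target ▸ hγ.mapsTo (right_mem_Icc.2 hγ.le)

theorem IsKobayashiQuasiGeodesic.sub_le (hγ : IsKobayashiQuasiGeodesic Ω lam x y a b γ)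
    (hlam : 0 < lam) : b - a ≤ lam * kobayashiDist Ω x y := by
  have h := hγ.lower a (left_mem_Icc.2 hγ.le) b (right_mem_Icc.2 hγ.le)
  rwa [hγ.source, hγ.target, abs_sub_comm, abs_of_nonneg (sub_nonneg.2 hγ.le),
    inv_mul_le_iff₀ hlam] at h

theorem IsKobayashiQuasiGeodesic.euclideanLength_eq_zero
    (hγ : IsKobayashiQuasiGeodesic Ω lam x x a b γ) (hO : IsOpen Ω) (hC : Convex ℝ Ω)
    (hlam : 0 < lam) : euclideanLength γ a b = 0 := by
  have h := hγ.sub_le hlam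
  rw [kobayashiDist_self hO hC hγ.source_mem, mul_zero] at h
  obtain rfl : a = b := hγ.le.antisymm (sub_nonpos.1 h)
  rw [euclideanLength, Icc_self, eVariationOn.subsingleton γ subsingleton_singleton]

theorem kobayashiDist_le_two_mul_norm_div (hO : IsOpen Ω) (hC : Convex ℝ Ω)
    (hδ : 0 < bdryDist Ω x) (hx : x ∈ Ω) (hxy : 2 * ‖x - y‖ ≤ bdryDist Ω x) :
    kobayashiDist Ω x y ≤ 2 * ‖x - y‖ / bdryDist Ω x := by
  have hball := ball_bdryDist_subset hO hx
  have hdist := kobayashiDist_le_norm_div (y := y) hC (half_pos hδ)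
    ((Metric.ball_subset_ball (half_le_self hδ.le)).trans hball)
    ((Metric.ball_subset_ball' (by rw [dist_comm, dist_eq_norm]; linarith)).trans hball)
  refine hdist.trans_eq ?_
  rw [norm_sub_rev]
  field_simp

theorem IsKobayashiQuasiGeodesic.dist_le_mul_sub (hγ : IsKobayashiQuasiGeodesic Ω lam x y a b γ)
    (hlam : 0 ≤ lam) : ∀ s ∈ Icc a b, ∀ t ∈ Icc a b,
      kobayashiDist Ω (γ s) (γ t) ≤ lam * (b - a) :=
  fun s hs t ht => (hγ.upper s hs t ht).trans <|
    mul_le_mul_of_nonneg_left (abs_sub_le_of_le_of_le hs.1 hs.2 ht.1 ht.2) hlam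

theorem IsKobayashiQuasiGeodesic.bdryDist_le_mul_exp [ProperSpace E]
    (hγ : IsKobayashiQuasiGeodesic Ω lam x y a b γ) (hO : IsOpen Ω) (hC : Convex ℝ Ω)
    (hne : (frontier Ω).Nonempty) (hlam : 0 ≤ lam) : ∀ s ∈ Icc a b,
      bdryDist Ω (γ s) ≤ bdryDist Ω x * Real.exp (2 * (lam * (b - a))) := fun s hs => by
  have hxs := hγ.dist_le_mul_sub hlam s hs a (left_mem_Icc.2 hγ.le)
  rw [hγ.source] at hxs
  refine (GehringHayman.bdryDist_le_mul_exp hO hC hne (hγ.mapsTo hs) hγ.source_mem).trans ?_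
  gcongr
  exact Metric.infDist_nonneg

theorem rpow_mul_div_le_rpow {d δ p : ℝ} (hδ : 0 < δ) (hd : 0 ≤ d) (hdδ : d ≤ δ) (hp : p ≤ 1) :
    δ ^ p * (d / δ) ≤ d ^ p :=
  calc δ ^ p * (d / δ) ≤ δ ^ p * (d / δ) ^ p := by
        gcongr
        exact Real.self_le_rpow_of_le_one (by positivity) ((div_le_one hδ).2 hdδ) hp
    _ = d ^ p := by rw [← Real.mul_rpow hδ.le (by positivity), mul_div_cancel₀ _ hδ.ne']

theorem exists_length_le_of_two_mul_norm_le [ProperSpace E] {m : ℝ} (h : IsBoundedMConvex m Ω)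
    (hne : (frontier Ω).Nonempty) (hlam : 1 ≤ lam) :
    ∃ C : ℝ, 0 < C ∧ ∀ (x y : E) (a b : ℝ) (γ : ℝ → E),
      IsKobayashiQuasiGeodesic Ω lam x y a b γ → 2 * ‖x - y‖ ≤ bdryDist Ω x →
      euclideanLength γ a b ≤ ENNReal.ofReal (C * ‖x - y‖ ^ (1 / m)) := by
  obtain ⟨C, hC₀, hC⟩ := h.exists_norm_sub_le
  have hlam₀ : 0 < lam := one_pos.trans_le hlam
  have hm₁ : 1 / m ≤ 1 := (div_le_one (one_pos.trans h.one_lt)).2 h.one_lt.le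
  set M := lam * lam
  set A := C * Real.exp (2 * M) * Real.exp (2 * M) ^ (1 / m) * lam with hA
  refine ⟨A * (lam * 2), by positivity, fun x y a b γ hγ hxy => ?_⟩
  have hδ := bdryDist_pos h.isOpen hne hγ.source_mem
  have htime : b - a ≤ lam * (2 * ‖x - y‖ / bdryDist Ω x) := (hγ.sub_le hlam₀).trans <|
    mul_le_mul_of_nonneg_left
      (kobayashiDist_le_two_mul_norm_div h.isOpen h.convex hδ hγ.source_mem hxy) hlam₀.le
  have htime' : lam * (b - a) ≤ M := mul_le_mul_of_nonneg_left
    (htime.trans (mul_le_of_le_one_right hlam₀.le ((div_le_one hδ).2 hxy))) hlam₀.le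
  have hbdry : ∀ s ∈ Icc a b, bdryDist Ω (γ s) ≤ bdryDist Ω x * Real.exp (2 * M) := fun s hs =>
    (hγ.bdryDist_le_mul_exp h.isOpen h.convex hne hlam₀.le s hs).trans (by gcongr)
  have hstep : ∀ s ∈ Icc a b, ∀ t ∈ Icc a b, s ≤ t → t - s ≤ 1 →
      dist (γ s) (γ t) ≤ A * bdryDist Ω x ^ (1 / m) * t - A * bdryDist Ω x ^ (1 / m) * s := by
    intro s hs t ht hst _
    have hnorm := hC _ (hγ.mapsTo hs) _ (hγ.mapsTo ht) _ _ (hbdry s hs)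
      ((hγ.dist_le_mul_sub hlam₀.le s hs t ht).trans htime')
    have hst' := hγ.upper s hs t ht
    rw [abs_sub_comm, abs_of_nonneg (sub_nonneg.2 hst)] at hst'
    rw [← dist_eq_norm', Real.mul_rpow hδ.le (Real.exp_pos _).le] at hnorm
    refine (hnorm.trans (mul_le_mul_of_nonneg_left hst' (by positivity))).trans_eq ?_
    rw [hA]
    ring
  refine (eVariationOn_le_of_forall_step_le one_pos hγ.le hstep).trans
    (ENNReal.ofReal_le_ofReal ?_)
  calc A * bdryDist Ω x ^ (1 / m) * b - A * bdryDist Ω x ^ (1 / m) * a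
      = A * bdryDist Ω x ^ (1 / m) * (b - a) := by ring
    _ ≤ A * bdryDist Ω x ^ (1 / m) * (lam * (2 * ‖x - y‖ / bdryDist Ω x)) := by gcongr
    _ = A * (lam * 2) * (bdryDist Ω x ^ (1 / m) * (‖x - y‖ / bdryDist Ω x)) := by ring
    _ ≤ A * (lam * 2) * ‖x - y‖ ^ (1 / m) := by
        gcongr
        exact rpow_mul_div_le_rpow hδ (norm_nonneg _) (by linarith [norm_nonneg (x - y)]) hm₁

/-- The Kobayashi distance from `x` at which a geodesic from `x` to `y` is expected to be farthest
from `∂Ω`: the boundary distance grows like `δ_Ω(x) e^{2t}` until it is comparable to `|x - y|`. -/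
noncomputable def peakDist (Ω : Set E) (x y : E) : ℝ := 1 / 2 * Real.log (‖x - y‖ / bdryDist Ω x)

theorem bdryDist_le_mul_exp_sub_peakDist [ProperSpace E] (hO : IsOpen Ω) (hC : Convex ℝ Ω)
    (hne : (frontier Ω).Nonempty) (hx : x ∈ Ω) (hz : z ∈ Ω) (hxy : 0 < ‖x - y‖) :
    bdryDist Ω z ≤ ‖x - y‖ * Real.exp (2 * (kobayashiDist Ω x z - peakDist Ω x y)) := by
  have hδ := bdryDist_pos hO hne hx
  have hpeak : bdryDist Ω x = ‖x - y‖ * Real.exp (-(2 * peakDist Ω x y)) := by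
    rw [peakDist, ← mul_assoc, mul_one_div_cancel two_ne_zero, one_mul, Real.exp_neg,
      Real.exp_log (by positivity)]
    field_simp
  calc bdryDist Ω z ≤ bdryDist Ω x * Real.exp (2 * kobayashiDist Ω x z) := by
        rw [kobayashiDist_comm Ω x z]
        exact bdryDist_le_mul_exp hO hC hne hz hx
    _ = ‖x - y‖ * Real.exp (2 * (kobayashiDist Ω x z - peakDist Ω x y)) := by
        rw [hpeak, mul_assoc, ← Real.exp_add]
        ring_nf

theorem log_one_add_div_le {d δ : ℝ} (hd : 0 < d) (hδ : 0 < δ) (hδd : δ ≤ 3 * d) :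
    Real.log (1 + d / δ) ≤ Real.log 4 + Real.log (d / δ) := by
  rw [← Real.log_mul (by norm_num) (by positivity)]
  refine Real.log_le_log (by positivity) ?_
  have : 1 ≤ 3 * (d / δ) := by rwa [← mul_div_assoc, one_le_div hδ]
  linarith

theorem bdryDist_le_mul_exp_peakDist_sub [ProperSpace E] (hO : IsOpen Ω) (hC : Convex ℝ Ω)
    (hne : (frontier Ω).Nonempty) {C H : ℝ} (hx : x ∈ Ω) (hy : y ∈ Ω) (hz : z ∈ Ω)
    (hxy : 0 < ‖x - y‖)
    (hdist : kobayashiDist Ω x y ≤ 1 / 2 * Real.log (1 + ‖x - y‖ / bdryDist Ω x) +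
      1 / 2 * Real.log (1 + ‖x - y‖ / bdryDist Ω y) + C)
    (hδx : bdryDist Ω x ≤ 3 * ‖x - y‖) (hδy : bdryDist Ω y ≤ 3 * ‖x - y‖)
    (hz' : basedProduct (kobayashiDist Ω) x y z ≤ H) :
    bdryDist Ω z ≤ 16 * Real.exp (2 * C + 4 * H) * ‖x - y‖ *
      Real.exp (2 * (peakDist Ω x y - kobayashiDist Ω x z)) := by
  have hδx₀ := bdryDist_pos hO hne hx
  have hδy₀ := bdryDist_pos hO hne hy
  have hzy : 2 * kobayashiDist Ω z y ≤ 2 * Real.log 4 + (2 * C + 4 * H) +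
      Real.log (‖x - y‖ / bdryDist Ω y) + 2 * (peakDist Ω x y - kobayashiDist Ω x z) := by
    have hlogx := log_one_add_div_le hxy hδx₀ hδx
    have hlogy := log_one_add_div_le hxy hδy₀ hδy
    unfold basedProduct at hz'
    unfold peakDist
    linarith
  have hexp : Real.exp (2 * Real.log 4) = 16 := by
    rw [two_mul, Real.exp_add, Real.exp_log (by norm_num)]
    norm_num
  calc bdryDist Ω z ≤ bdryDist Ω y * Real.exp (2 * kobayashiDist Ω z y) :=
        bdryDist_le_mul_exp hO hC hne hz hy
    _ ≤ bdryDist Ω y * Real.exp (2 * Real.log 4 + (2 * C + 4 * H) +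
          Real.log (‖x - y‖ / bdryDist Ω y) + 2 * (peakDist Ω x y - kobayashiDist Ω x z)) := by
        gcongr
    _ = _ := by
        rw [Real.exp_add, Real.exp_add, Real.exp_add, hexp, Real.exp_log (by positivity)]
        field_simp

theorem bdryDist_le_mul_exp_neg_abs [ProperSpace E] (hO : IsOpen Ω) (hC : Convex ℝ Ω)
    (hne : (frontier Ω).Nonempty) {C H : ℝ} (hC₀ : 0 ≤ C) (hH : 0 ≤ H) (hx : x ∈ Ω) (hy : y ∈ Ω)
    (hz : z ∈ Ω) (hxy : 0 < ‖x - y‖)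
    (hdist : kobayashiDist Ω x y ≤ 1 / 2 * Real.log (1 + ‖x - y‖ / bdryDist Ω x) +
      1 / 2 * Real.log (1 + ‖x - y‖ / bdryDist Ω y) + C)
    (hδx : bdryDist Ω x ≤ 3 * ‖x - y‖) (hδy : bdryDist Ω y ≤ 3 * ‖x - y‖)
    (hz' : basedProduct (kobayashiDist Ω) x y z ≤ H) :
    bdryDist Ω z ≤ 16 * Real.exp (2 * C + 4 * H) * ‖x - y‖ *
      Real.exp (-(2 * |kobayashiDist Ω x z - peakDist Ω x y|)) := by
  rcases le_total (peakDist Ω x y) (kobayashiDist Ω x z) with hle | hle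
  · rw [abs_of_nonneg (sub_nonneg.2 hle), ← mul_neg, neg_sub]
    exact bdryDist_le_mul_exp_peakDist_sub hO hC hne hx hy hz hxy hdist hδx hδy hz'
  · rw [abs_of_nonpos (sub_nonpos.2 hle), mul_neg, neg_neg]
    refine (bdryDist_le_mul_exp_sub_peakDist hO hC hne hx hz hxy).trans ?_
    gcongr
    have := Real.one_le_exp (x := 2 * C + 4 * H) (by positivity)
    exact le_mul_of_one_le_left hxy.le (by linarith)

theorem exists_forall_mul_abs_sub_le {f : ℝ → ℝ} {k H : ℝ} (hab : a ≤ b)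
    (hcont : ContinuousOn f (Icc a b))
    (hgrow : ∀ s ∈ Icc a b, ∀ t ∈ Icc a b, k * |s - t| ≤ |f s - f t| + H) (A : ℝ) :
    ∃ t₀ ∈ Icc a b, ∀ t ∈ Icc a b, k * |t - t₀| ≤ 2 * |f t - A| + H := by
  obtain ⟨t₀, ht₀, hmin⟩ := isCompact_Icc.exists_isMinOn (nonempty_Icc.2 hab)
    (hcont.sub continuousOn_const).abs
  refine ⟨t₀, ht₀, fun t ht => (hgrow t ht t₀ ht₀).trans ?_⟩
  have hle : |f t₀ - A| ≤ |f t - A| := hmin ht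
  have htri := abs_sub_le (f t) A (f t₀)
  rw [abs_sub_comm A] at htri
  linarith

theorem IsKobayashiQuasiGeodesic.continuousOn_dist (hγ : IsKobayashiQuasiGeodesic Ω lam x y a b γ)
    (hO : IsOpen Ω) (hC : Convex ℝ Ω) (hlam : 0 ≤ lam) :
    ContinuousOn (fun t => kobayashiDist Ω x (γ t)) (Icc a b) := by
  refine (LipschitzOnWith.of_le_add_mul ⟨lam, hlam⟩ fun s hs t ht => ?_).continuousOn
  refine (kobayashiDist_triangle hO hC hγ.source_mem (hγ.mapsTo ht) (hγ.mapsTo hs)).trans ?_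
  rw [kobayashiDist_comm Ω (γ t)]
  exact add_le_add_right (hγ.upper s hs t ht) _

theorem IsKobayashiQuasiGeodesic.le_abs_dist_sub_dist {H : ℝ}
    (hγ : IsKobayashiQuasiGeodesic Ω lam x y a b γ)
    (hthin : ∀ t ∈ Icc a b, ∀ s ∈ Icc a t, basedProduct (kobayashiDist Ω) x (γ t) (γ s) ≤ H) :
    ∀ s ∈ Icc a b, ∀ t ∈ Icc a b,
      lam⁻¹ * |s - t| ≤ |kobayashiDist Ω x (γ s) - kobayashiDist Ω x (γ t)| + 2 * H := by
  have hle : ∀ s ∈ Icc a b, ∀ t ∈ Icc a b, s ≤ t →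
      lam⁻¹ * |s - t| ≤ |kobayashiDist Ω x (γ s) - kobayashiDist Ω x (γ t)| + 2 * H := by
    intro s hs t ht hst
    have hprod := hthin t ht s ⟨hs.1, hst⟩
    unfold basedProduct at hprod
    linarith [hγ.lower s hs t ht,
      neg_le_abs (kobayashiDist Ω x (γ s) - kobayashiDist Ω x (γ t))]
  intro s hs t ht
  rcases le_total s t with hst | hts
  · exact hle s hs t ht hst
  · rw [abs_sub_comm s, abs_sub_comm (kobayashiDist Ω x (γ s))]
    exact hle t ht s hs hts

end QuasiGeodesicLength

section GehringHaymanInequality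

variable [ProperSpace E] {m lam H : ℝ}

theorem exists_bdryDist_le_mul_exp_neg (h : IsBoundedMConvex m Ω)
    (hD : HasDiniSmoothBoundary Ω) (hne : (frontier Ω).Nonempty) (hlam : 0 ≤ lam) (hH : 0 ≤ H) :
    ∃ B : ℝ, 0 < B ∧ ∀ (x y : E) (a b : ℝ) (γ : ℝ → E), IsKobayashiQuasiGeodesic Ω lam x y a b γ →
      (∀ t ∈ Icc a b, ∀ s ∈ Icc a t, basedProduct (kobayashiDist Ω) x (γ t) (γ s) ≤ H) →
      x ≠ y → bdryDist Ω x ≤ 2 * ‖x - y‖ →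
      ∃ t₀ ∈ Icc a b, ∀ t ∈ Icc a b,
        bdryDist Ω (γ t) ≤ B * ‖x - y‖ * Real.exp (-(lam⁻¹ * |t - t₀|)) := by
  obtain ⟨C, hC₀, hC⟩ := exists_kobayashiDist_le h.isOpen h.convex h.bounded hne hD
  refine ⟨16 * Real.exp (2 * C + 4 * H) * Real.exp (2 * H), by positivity,
    fun x y a b γ hγ hthin hxy hδx => ?_⟩
  have hd : 0 < ‖x - y‖ := norm_pos_iff.2 (sub_ne_zero.2 hxy)
  have hδy : bdryDist Ω y ≤ 3 * ‖x - y‖ := by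
    have := bdryDist_le_add Ω y x
    rw [norm_sub_rev] at this
    linarith
  obtain ⟨t₀, ht₀, hgrow⟩ := exists_forall_mul_abs_sub_le hγ.le
    (hγ.continuousOn_dist h.isOpen h.convex hlam) (hγ.le_abs_dist_sub_dist hthin)
    (peakDist Ω x y)
  refine ⟨t₀, ht₀, fun t ht => ?_⟩
  have hprod := hthin b (right_mem_Icc.2 hγ.le) t ht
  rw [hγ.target] at hprod
  calc bdryDist Ω (γ t) ≤ 16 * Real.exp (2 * C + 4 * H) * ‖x - y‖ *
        Real.exp (-(2 * |kobayashiDist Ω x (γ t) - peakDist Ω x y|)) :=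
        bdryDist_le_mul_exp_neg_abs h.isOpen h.convex hne hC₀ hH hγ.source_mem hγ.target_mem
          (hγ.mapsTo ht) hd (hC x hγ.source_mem y hγ.target_mem hxy) (by linarith) hδy hprod
    _ ≤ 16 * Real.exp (2 * C + 4 * H) * ‖x - y‖ *
        Real.exp (2 * H + -(lam⁻¹ * |t - t₀|)) := by
        gcongr
        linarith [hgrow t ht]
    _ = _ := by rw [Real.exp_add (2 * H)]; ring

theorem exists_length_le_of_bdryDist_le (h : IsBoundedMConvex m Ω)
    (hD : HasDiniSmoothBoundary Ω) (hne : (frontier Ω).Nonempty) (hlam : 1 ≤ lam) (hH : 0 ≤ H) :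
    ∃ C : ℝ, 0 < C ∧ ∀ (x y : E) (a b : ℝ) (γ : ℝ → E), IsKobayashiQuasiGeodesic Ω lam x y a b γ →
      (∀ t ∈ Icc a b, ∀ s ∈ Icc a t, basedProduct (kobayashiDist Ω) x (γ t) (γ s) ≤ H) →
      x ≠ y → bdryDist Ω x ≤ 2 * ‖x - y‖ →
      euclideanLength γ a b ≤ ENNReal.ofReal (C * ‖x - y‖ ^ (1 / m)) := by
  have hm₀ : 0 < m := one_pos.trans h.one_lt
  have hlam₀ : 0 < lam := one_pos.trans_le hlam
  obtain ⟨C, hC₀, hC⟩ := h.exists_norm_sub_le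
  obtain ⟨B, hB₀, hB⟩ := exists_bdryDist_le_mul_exp_neg h hD hne hlam₀.le hH
  set c := 1 / (lam * m) with hc
  set K := C * Real.exp (2 * lam) * B ^ (1 / m) * lam with hK
  refine ⟨2 * K / c, by positivity, fun x y a b γ hγ hthin hxy hδ => ?_⟩
  obtain ⟨t₀, ht₀, hdecay⟩ := hB x y a b γ hγ hthin hxy hδ
  have hpow (s : ℝ) : (B * ‖x - y‖ * Real.exp (-(lam⁻¹ * |s - t₀|))) ^ (1 / m) =
      B ^ (1 / m) * ‖x - y‖ ^ (1 / m) * Real.exp (-(c * |s - t₀|)) := by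
    rw [Real.mul_rpow (by positivity) (by positivity), Real.mul_rpow hB₀.le (norm_nonneg _),
      ← Real.exp_mul, hc]
    congr 2
    field_simp
  have hstep : ∀ s ∈ Icc a b, ∀ t ∈ Icc a b, |s - t| ≤ 1 →
      dist (γ s) (γ t) ≤ K * ‖x - y‖ ^ (1 / m) * Real.exp (-(c * |s - t₀|)) * |s - t| := by
    intro s hs t ht hst
    have hdist := hγ.upper s hs t ht
    have hnorm := hC _ (hγ.mapsTo hs) _ (hγ.mapsTo ht) _ lam (hdecay s hs)
      (hdist.trans (mul_le_of_le_one_right hlam₀.le hst))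
    rw [← dist_eq_norm', hpow] at hnorm
    refine (hnorm.trans (mul_le_mul_of_nonneg_left hdist (by positivity))).trans_eq ?_
    rw [hK]
    ring
  refine (eVariationOn_le_of_exp_decay one_pos (by positivity) (by positivity) ht₀ hstep).trans_eq
    ?_
  congr 1
  ring

theorem exists_length_le (h : IsBoundedMConvex m Ω) (hD : HasDiniSmoothBoundary Ω)
    (hlam : 1 ≤ lam) (hH : 0 ≤ H) :
    ∃ C : ℝ, 0 < C ∧ ∀ (x y : E) (a b : ℝ) (γ : ℝ → E), IsKobayashiQuasiGeodesic Ω lam x y a b γ →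
      (∀ t ∈ Icc a b, ∀ s ∈ Icc a t, basedProduct (kobayashiDist Ω) x (γ t) (γ s) ≤ H) →
      euclideanLength γ a b ≤ ENNReal.ofReal (C * ‖x - y‖ ^ (1 / m)) := by
  have hconst (C : ℝ) {x : E} {a b : ℝ} {γ : ℝ → E}
      (hγ : IsKobayashiQuasiGeodesic Ω lam x x a b γ) :
      euclideanLength γ a b ≤ ENNReal.ofReal (C * ‖x - x‖ ^ (1 / m)) :=
    (hγ.euclideanLength_eq_zero h.isOpen h.convex (one_pos.trans_le hlam)).trans_le zero_le
  rcases subsingleton_or_nontrivial E with hE | hE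
  · refine ⟨1, one_pos, fun x y a b γ hγ _ => ?_⟩
    obtain rfl := Subsingleton.elim x y
    exact hconst 1 hγ
  have hne := h.frontier_nonempty
  obtain ⟨C₁, hC₁, hnear⟩ := exists_length_le_of_two_mul_norm_le h hne hlam
  obtain ⟨C₂, -, hfar⟩ := exists_length_le_of_bdryDist_le h hD hne hlam hH
  refine ⟨max C₁ C₂, lt_max_of_lt_left hC₁, fun x y a b γ hγ hthin => ?_⟩
  have hmono {C : ℝ} (hC : C ≤ max C₁ C₂) : ENNReal.ofReal (C * ‖x - y‖ ^ (1 / m)) ≤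
      ENNReal.ofReal (max C₁ C₂ * ‖x - y‖ ^ (1 / m)) := by gcongr
  rcases eq_or_ne x y with rfl | hxy
  · exact hconst _ hγ
  rcases le_total (2 * ‖x - y‖) (bdryDist Ω x) with hle | hle
  · exact (hnear x y a b γ hγ hle).trans (hmono (le_max_left _ _))
  · exact (hfar x y a b γ hγ hthin hxy hle).trans (hmono (le_max_right _ _))

end GehringHaymanInequality

theorem IsKobayashiGeodesic.isKobayashiQuasiGeodesic {x y : E} {γ : ℝ → E}
    (hγ : IsKobayashiGeodesic Ω x y γ) :
    IsKobayashiQuasiGeodesic Ω 1 x y 0 (kobayashiDist Ω x y) γ where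
  le := kobayashiDist_nonneg Ω x y
  mapsTo := hγ.mapsTo
  source := hγ.source
  target := hγ.target
  lower s hs t ht := by rw [hγ.isometry s hs t ht, inv_one, one_mul]
  upper s hs t ht := by rw [hγ.isometry s hs t ht, one_mul]

theorem IsKobayashiGeodesic.basedProduct_eq_zero {x y : E} {γ : ℝ → E} {s t : ℝ}
    (hγ : IsKobayashiGeodesic Ω x y γ) (ht : t ∈ Icc 0 (kobayashiDist Ω x y))
    (hs : s ∈ Icc 0 t) : basedProduct (kobayashiDist Ω) x (γ t) (γ s) = 0 := by
  have hs' : s ∈ Icc 0 (kobayashiDist Ω x y) := ⟨hs.1, hs.2.trans ht.2⟩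
  have hdist {r : ℝ} (hr : r ∈ Icc 0 (kobayashiDist Ω x y)) : kobayashiDist Ω x (γ r) = r := by
    have h := hγ.isometry 0 (left_mem_Icc.2 (hr.1.trans hr.2)) r hr
    rwa [hγ.source, zero_sub, abs_neg, abs_of_nonneg hr.1] at h
  rw [basedProduct, hdist hs', hdist ht, hγ.isometry s hs' t ht, abs_sub_comm,
    abs_of_nonneg (sub_nonneg.2 hs.2)]
  ring

theorem IsKobayashiGromovHyperbolic.exists_isGromovHyperbolicOn
    (h : IsKobayashiGromovHyperbolic Ω) (hO : IsOpen Ω) (hC : Convex ℝ Ω) :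
    ∃ δ : ℝ, 0 < δ ∧ IsGromovHyperbolicOn (kobayashiDist Ω) Ω δ := by
  obtain ⟨δ, hδ, h⟩ := h
  refine ⟨δ + 1, by positivity, fun x _ y _ => kobayashiDist_comm Ω x y,
    fun x hx y hy z hz => kobayashiDist_triangle hO hC hx hy hz, fun x hx y hy z hz w hw => ?_⟩
  have hmin := h x hx y hy z hz w hw
  simp only [gromovProduct, kobayashiDist_comm Ω z y, sub_le_iff_le_add, min_le_iff] at hmin
  rcases hmin with hle | hle
  · linarith [le_max_left (kobayashiDist Ω x z + kobayashiDist Ω y w)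
      (kobayashiDist Ω x w + kobayashiDist Ω y z)]
  · linarith [le_max_right (kobayashiDist Ω x z + kobayashiDist Ω y w)
      (kobayashiDist Ω x w + kobayashiDist Ω y z)]

theorem IsKobayashiQuasiGeodesic.basedProduct_le {lam a b δ s t : ℝ} {x y : E} {γ : ℝ → E}
    (hγ : IsKobayashiQuasiGeodesic Ω lam x y a b γ)
    (hδ : 0 < δ) (hD : IsGromovHyperbolicOn (kobayashiDist Ω) Ω δ) (hlam : 1 ≤ lam)
    (ht : t ∈ Icc a b) (hs : s ∈ Icc a t) :
    basedProduct (kobayashiDist Ω) x (γ t) (γ s) ≤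
      2 * lam ^ 2 * (4 * lam ^ 2 + 4) * δ := by
  have hsub : Icc a t ⊆ Icc a b := Icc_subset_Icc_right ht.2
  rw [← hγ.source]
  exact quasiGeodesic_stability hD hδ hlam (hγ.mapsTo.mono_left hsub)
    (fun u hu v hv => hγ.lower u (hsub hu) v (hsub hv))
    (fun u hu v hv => hγ.upper u (hsub hu) v (hsub hv)) hs

end GehringHayman

open GehringHayman in
theorem theorem1p6_general {E : Type*} [NormedAddCommGroup E] [InnerProductSpace ℂ E]
    [ProperSpace E] {m : ℝ} {Ω : Set E} (hΩ : IsBoundedMConvex m Ω)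
    (hDini : HasDiniSmoothBoundary Ω) :
    (∃ C : ℝ, 0 < C ∧ ∀ x ∈ Ω, ∀ y ∈ Ω, ∀ γ : ℝ → E, IsKobayashiGeodesic Ω x y γ →
      euclideanLength γ 0 (kobayashiDist Ω x y) ≤ ENNReal.ofReal (C * ‖x - y‖ ^ (1 / m))) ∧
    (IsKobayashiGromovHyperbolic Ω → ∀ lam : ℝ, 1 ≤ lam → ∃ C' : ℝ, 0 < C' ∧
      ∀ x ∈ Ω, ∀ y ∈ Ω, ∀ (a b : ℝ) (γ : ℝ → E), IsKobayashiQuasiGeodesic Ω lam x y a b γ →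
        euclideanLength γ a b ≤ ENNReal.ofReal (C' * ‖x - y‖ ^ (1 / m))) := by
  refine ⟨?_, fun hG lam hlam => ?_⟩
  · obtain ⟨C, hC₀, hC⟩ := exists_length_le hΩ hDini le_rfl le_rfl
    exact ⟨C, hC₀, fun x _ y _ γ hγ => hC x y _ _ γ hγ.isKobayashiQuasiGeodesic
      fun t ht s hs => (hγ.basedProduct_eq_zero ht hs).le⟩
  · obtain ⟨δ, hδ, hhyp⟩ := hG.exists_isGromovHyperbolicOn hΩ.isOpen hΩ.convex
    obtain ⟨C, hC₀, hC⟩ := exists_length_le (H := 2 * lam ^ 2 * (4 * lam ^ 2 + 4) * δ) hΩ hDini hlam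
      (by positivity)
    exact ⟨C, hC₀, fun x _ y _ a b γ hγ => hC x y a b γ hγ
      fun t ht s hs => hγ.basedProduct_le hδ hhyp hlam ht hs⟩

theorem theorem1p6 (n : ℕ) (hn : 2 ≤ n) (m : ℝ) (Ω : Set (EuclideanSpace ℂ (Fin n)))
    (hΩ : GehringHayman.IsBoundedMConvex m Ω) (hDini : GehringHayman.HasDiniSmoothBoundary Ω) :
    (∃ C : ℝ, 0 < C ∧ ∀ x ∈ Ω, ∀ y ∈ Ω, ∀ γ : ℝ → EuclideanSpace ℂ (Fin n),
      GehringHayman.IsKobayashiGeodesic Ω x y γ →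
        GehringHayman.euclideanLength γ 0 (GehringHayman.kobayashiDist Ω x y) ≤
          ENNReal.ofReal (C * ‖x - y‖ ^ (1 / m))) ∧
    (GehringHayman.IsKobayashiGromovHyperbolic Ω →
      ∀ lam : ℝ, 1 ≤ lam → ∃ C' : ℝ, 0 < C' ∧
        ∀ x ∈ Ω, ∀ y ∈ Ω, ∀ (a b : ℝ) (γ : ℝ → EuclideanSpace ℂ (Fin n)),
          GehringHayman.IsKobayashiQuasiGeodesic Ω lam x y a b γ →
            GehringHayman.euclideanLength γ a b ≤
              ENNReal.ofReal (C' * ‖x - y‖ ^ (1 / m))) :=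
  theorem1p6_general hΩ hDini
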